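/- Let $W$ be the principal branch of the Lambert $W$ function, the inverse of $w\mapsto we^{w}$ on $[-1,\infty)$. For a two-sided sequence $\mathbf X=(X_t)_{t\in\mathbb Z}$ of real random variables and a positive integer $a$, let $$\beta(a)=\sup_t\big\|\mathbb P_{-\infty}^t\otimes\mathbb P_{t+a}^{\infty}-\mathbb P_{t,a}\big\|_{TV},$$ where $\mathbb P_{-\infty}^t$ and $\mathbb P_{t+a}^\infty$ are the laws of $(X_s)_{s\le t}$ and $(X_s)_{s\ge t+a}$, $\mathbb P_{t,a}$ is their joint law, and $\|\mu-\nu\|_{TV}=\sup_C|\mu(C)-\nu(C)|$ over measurable sets $C$. The process is $\beta$-mixing if $\beta(a)\to0$ as $a\to\infty$. Given a sample $X_1,\dots,X_n$, a dimension $d\ge1$ and a bandwidth $h>0$, let $\hat f^{d}$ be the histogram on $\mathbb R^d$, with bins the cubes of side $h$ of the grid through the origin, of the $n-d+1$ windows $(X_{i+1},\dots,X_{i+d})$, and let $\hat f_a^{2d}$ be the histogram on $\mathbb R^{2d}$, with the same $h$, of the $n-2d-a+2$ pairs of windows $\big((X_{i+1},\dots,X_{i+d}),(X_{i+d+a},\dots,X_{i+2d+a-1})\big)$.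 (A histogram of $N$ points in $\mathbb R^m$ takes on each bin the value $\#\{\text{points in the bin}\}/(Nh^m)$.) Put $$\hat\beta^{d}(a)=\frac12\int_{\mathbb R^{d}\times\mathbb R^d}\big|\hat f_a^{2d}-\hat f^d\otimes\hat f^d\big|.$$ **Theorem.** Let $d_n\to\infty$ be integers with $d_n=O(\exp\{W(\log n)\})$, say $d_n\le C\exp\{W(\log n)\}$ for all large $n$. Let $\gamma>0$ satisfy $2C\gamma<1$, and let the bandwidths satisfy $h_n\sim n^{-\gamma k_n}$, where $$k_n=\frac{W(\log n)+\frac12\log n}{\log n\,\big(\frac12\exp\{W(\log n)\}+1\big)}.$$ Then, for every stationary $\beta$-mixing process $\mathbf X$ of real random variables with $\mathbb E\log(1+|X_0|)<\infty$ (for instance, bounded ones) and every positive integer $a$, the estimator $\hat\beta^{d_n}(a)$ computed from $X_1,\dots,X_n$ with bandwidth $h_n$ converges in probability to $\beta(a)$ as $n\to\infty$. -/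

import Mathlib

open MeasureTheory Filter Topology Asymptotics

namespace BetaMixing

noncomputable section

/-- The total variation distance `sup_C |μ(C) - ν(C)|`, over all measurable sets `C`, of two
probability measures. -/
def tvDist {S : Type*} [MeasurableSpace S] (μ ν : Measure S) : ℝ :=
  ⨆ C : {C : Set S // MeasurableSet C}, |μ.real C - ν.real C|

/-- All finite-dimensional distributions are invariant under time shifts: the vectors
`(X_t, …, X_{t+i})` and `(X_{t+j}, …, X_{t+i+j})` have the same law. -/
def IsStationary {Ω : Type*} [MeasurableSpace Ω] (P : Measure Ω) (X : ℤ → Ω → ℝ) : Prop :=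
  ∀ (t : ℤ) (i j : ℕ),
    P.map (fun ω (k : Fin (i + 1)) => X (t + (k : ℕ)) ω) =
      P.map (fun ω (k : Fin (i + 1)) => X (t + j + (k : ℕ)) ω)

/-- The past `(X_t, X_{t-1}, X_{t-2}, …)` of the process up to time `t`. -/
def past {Ω : Type*} (X : ℤ → Ω → ℝ) (t : ℤ) (ω : Ω) : ℕ → ℝ := fun k => X (t - k) ω

/-- The future `(X_s, X_{s+1}, X_{s+2}, …)` of the process from time `s` on. -/
def future {Ω : Type*} (X : ℤ → Ω → ℝ) (s : ℤ) (ω : Ω) : ℕ → ℝ := fun k => X (s + k) ω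

/-- The `β`-mixing coefficient at lag `a`: the supremum over `t` of the total variation distance
between the product of the laws of the past up to `t` and of the future from `t + a` on, and the
joint law of the two. -/
def betaCoeff {Ω : Type*} [MeasurableSpace Ω] (P : Measure Ω) (X : ℤ → Ω → ℝ) (a : ℕ) : ℝ :=
  ⨆ t : ℤ, tvDist ((P.map (past X t)).prod (P.map (future X (t + a))))
    (P.map (fun ω => (past X t ω, future X (t + a) ω)))

/-- The process is `β`-mixing (absolutely regular). -/
def IsBetaMixing {Ω : Type*} [MeasurableSpace Ω] (P : Measure Ω) (X : ℤ → Ω → ℝ) : Prop :=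
  Tendsto (betaCoeff P X) atTop (𝓝 0)

/-- The histogram density estimator on `ι → ℝ` computed from the `N` points `Y 0, …, Y (N - 1)`,
with bins the half-open cubes of side `h` of the grid through the origin: its value at `y` is the
number of points in the bin of `y`, divided by `N * h ^ (dimension)`. -/
def histogram {ι : Type*} [Fintype ι] (h : ℝ) (N : ℕ) (Y : ℕ → ι → ℝ) (y : ι → ℝ) : ℝ :=
  (((Finset.range N).filter fun i => ∀ k, ⌊Y i k / h⌋ = ⌊y k / h⌋).card : ℝ) /
    ((N : ℝ) * h ^ Fintype.card ι)

/-- The `d`-dimensional histogram from the `n - d + 1` windows `(x_{i+1}, …, x_{i+d})`,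
`0 ≤ i ≤ n - d`, of the sample `x_1, …, x_n`. -/
def histD (h : ℝ) (d n : ℕ) (x : ℕ → ℝ) : (Fin d → ℝ) → ℝ :=
  histogram h (n + 1 - d) fun i k => x (i + 1 + k)

/-- The `2d`-dimensional histogram of two blocks of `d` consecutive observations, the second one
starting `a` time steps after the end of the first one, from the `n - 2d - a + 2` such pairs
`(x_{i+1}, …, x_{i+d})`, `(x_{i+d+a}, …, x_{i+2d+a-1})` in the sample `x_1, …, x_n`. -/
def histPair (h : ℝ) (d a n : ℕ) (x : ℕ → ℝ) : (Fin d ⊕ Fin d → ℝ) → ℝ :=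
  histogram h (n + 2 - (2 * d + a)) fun i =>
    Sum.elim (fun k : Fin d => x (i + 1 + k)) (fun k : Fin d => x (i + d + a + k))

/-- The estimator of the `β`-mixing coefficient at lag `a` from the sample `x_1, …, x_n`: half the
`L¹` distance between the `2d`-dimensional histogram and the product of the `d`-dimensional
histogram with itself. -/
def betaHat (h : ℝ) (d a n : ℕ) (x : ℕ → ℝ) : ℝ :=
  1 / 2 * ∫ p : (Fin d → ℝ) × (Fin d → ℝ),
    |histPair h d a n x (Sum.elim p.1 p.2) - histD h d n x p.1 * histD h d n x p.2|

/-- The principal branch of the Lambert `W` function: the inverse of `w ↦ w * exp w` on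
`[-1, ∞)`. -/
def lambertW (y : ℝ) : ℝ := Function.invFunOn (fun w : ℝ => w * Real.exp w) (Set.Ici (-1)) y

/-- `exp (W (log n))`, the order of growth of the histogram dimension. -/
def dimRate (n : ℕ) : ℝ := Real.exp (lambertW (Real.log n))

/-- The exponent
`k_n = (W (log n) + (1/2) log n) / (log n * ((1/2) exp (W (log n)) + 1))`. -/
def bandwidthExponent (n : ℕ) : ℝ :=
  (lambertW (Real.log n) + 1 / 2 * Real.log n) /
    (Real.log n * (1 / 2 * Real.exp (lambertW (Real.log n)) + 1))

end

end BetaMixing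

/-! The cell volumes cancel against the histogram normalisations, so the estimator is half the ℓ¹
distance between the bin frequencies of pairs of windows and the products of bin frequencies of
single windows (`betaHat_eq_tsum`). It is compared with the same expression in the true bin
probabilities.

Bias. The bin probabilities are the discretised laws of (past, future), joint and product. As `d →
∞` and `h → 0`, each cell determines its points ever better in the product topology, and this alone
makes the discretised total variation distances converge to the full one
(`tendsto_tsum_abs_measureReal_map`, `tendsto_half_tsum_binProb`). No densities are needed.

Fluctuation. No mixing rate is available, so the indicator of each window event is centred by its
conditional probability given the past up to `g` steps before the window. Centred indicators far
enough apart are orthogonal, so their sums have variance linear in the sample size. In the mean, the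
discarded conditional probabilities differ from the bin probabilities by at most `2 β(g)`, summed
over all bins at once. Together these give `integral_sum_abs_binFreq_sub_le` on a finite set `S` of
bins, with error `√(2(ℓ+g)|S|/N) + 2β(g)`.

Bins. The data may be unbounded. `S` consists of bins on which the coordinatewise average of a
logarithmic size is at most `T`: a Chernoff-type count gives `|S| ≤ (3e^{2T}/h)^D`
(`exists_finset_bins`), and Markov's inequality bounds the remaining mass by a constant over `T`,
uniformly in the dimension (`one_sub_sum_binProb_le`).

Rates. With `w = W(log n)` one has `n = exp(w e^w)`, and the prescribed bandwidth order is exactly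
`e^{-γw}`. Since `d ≤ C e^w`, the bin count in dimension `2d` is at most `exp(2Cγ w e^w + O(e^w))`,
which is negligible against `n` because `2Cγ < 1`. Fixing `g` and `T` before letting `n → ∞`
finishes the proof. -/

namespace BetaMixing

/-! ### Total variation distance. -/

section TotalVariation

variable {S : Type*} [MeasurableSpace S]

theorem abs_measureReal_sub_le_one (μ ν : Measure S) [IsProbabilityMeasure μ]
    [IsProbabilityMeasure ν] (C : Set S) : |μ.real C - ν.real C| ≤ 1 := by
  have h1 : μ.real C ≤ 1 := measureReal_le_one
  have h2 : ν.real C ≤ 1 := measureReal_le_one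
  have h3 : 0 ≤ μ.real C := measureReal_nonneg
  have h4 : 0 ≤ ν.real C := measureReal_nonneg
  rw [abs_le]
  constructor <;> linarith

theorem abs_measureReal_sub_le_tvDist (μ ν : Measure S) [IsProbabilityMeasure μ]
    [IsProbabilityMeasure ν] {C : Set S} (hC : MeasurableSet C) :
    |μ.real C - ν.real C| ≤ tvDist μ ν := by
  refine le_ciSup (f := fun C : {C : Set S // MeasurableSet C} => |μ.real C.1 - ν.real C.1|)
    ⟨1, ?_⟩ ⟨C, hC⟩
  rintro _ ⟨C, rfl⟩
  exact abs_measureReal_sub_le_one μ ν C.1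

/-- Complementation changes the sign of the difference, so a one-sided bound is enough. -/
theorem tvDist_le (μ ν : Measure S) [IsProbabilityMeasure μ] [IsProbabilityMeasure ν] {b : ℝ}
    (h : ∀ C, MeasurableSet C → μ.real C - ν.real C ≤ b) : tvDist μ ν ≤ b := by
  have : Nonempty {C : Set S // MeasurableSet C} := ⟨⟨∅, MeasurableSet.empty⟩⟩
  refine ciSup_le fun C => abs_le.2 ⟨?_, h _ C.2⟩
  have := h _ C.2.compl
  rw [probReal_compl_eq_one_sub C.2, probReal_compl_eq_one_sub C.2] at this
  linarith

theorem tvDist_le_one (μ ν : Measure S) [IsProbabilityMeasure μ] [IsProbabilityMeasure ν] :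
    tvDist μ ν ≤ 1 :=
  tvDist_le μ ν fun C _ => (le_abs_self _).trans (abs_measureReal_sub_le_one μ ν C)

end TotalVariation

/-! ### Total variation on countable spaces as half an ℓ¹ distance. -/

section Discrete

variable {E : Type*} [MeasurableSpace E] [Countable E] [MeasurableSingletonClass E]

theorem hasSum_measureReal_singleton (μ : Measure E) [IsFiniteMeasure μ] (C : Set E) :
    HasSum (C.indicator fun c => μ.real {c}) (μ.real C) := by
  have hint : Integrable (C.indicator fun _ => (1 : ℝ)) μ :=
    (integrable_const 1).indicator C.to_countable.measurableSet
  have h := hasSum_integral_measure (μ := fun c => μ {c} • Measure.dirac c)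
    (f := C.indicator fun _ => (1 : ℝ)) (by rwa [Measure.sum_smul_dirac])
  rw [Measure.sum_smul_dirac, integral_indicator C.to_countable.measurableSet] at h
  simp only [setIntegral_const, smul_eq_mul, mul_one] at h
  refine h.congr_fun fun c => ?_
  rw [integral_smul_measure, integral_dirac]
  by_cases hc : c ∈ C <;> simp [hc, Measure.real]

/-- The Hahn set where `μ` dominates `ν` pointwise works: equal total masses force the positive and
negative parts of `μ - ν` to have the same sum. -/
theorem hasSum_abs_measureReal_sub (μ ν : Measure E) [IsProbabilityMeasure μ]
    [IsProbabilityMeasure ν] :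
    ∃ C : Set E, HasSum (fun c => |μ.real {c} - ν.real {c}|) (2 * (μ.real C - ν.real C)) := by
  set C : Set E := {c | ν.real {c} ≤ μ.real {c}}
  refine ⟨C, ?_⟩
  have h1 := (hasSum_measureReal_singleton μ C).sub (hasSum_measureReal_singleton ν C)
  have h2 := (hasSum_measureReal_singleton ν Cᶜ).sub (hasSum_measureReal_singleton μ Cᶜ)
  have hm := C.to_countable.measurableSet
  rw [probReal_compl_eq_one_sub hm, probReal_compl_eq_one_sub hm] at h2
  have h3 := h1.add h2
  rw [show μ.real C - ν.real C + (1 - ν.real C - (1 - μ.real C)) =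
    2 * (μ.real C - ν.real C) by ring] at h3
  refine h3.congr_fun fun c => ?_
  · 
    by_cases hc : c ∈ C
    · have : ν.real {c} ≤ μ.real {c} := hc
      simp [hc, abs_of_nonneg (sub_nonneg.2 this)]
    · have : μ.real {c} ≤ ν.real {c} := (not_le.1 hc).le
      simp [hc, abs_of_nonpos (sub_nonpos.2 this)]

theorem summable_abs_measureReal_sub (μ ν : Measure E) [IsProbabilityMeasure μ]
    [IsProbabilityMeasure ν] : Summable fun c => |μ.real {c} - ν.real {c}| :=
  (hasSum_abs_measureReal_sub μ ν).choose_spec.summable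

/-- Equal masses allow `f` to be recentred to `f - 1/2`, which is bounded by `1/2`; this is what
saves the factor two. -/
theorem integral_sub_integral_le_tsum_abs (μ ν : Measure E) [IsProbabilityMeasure μ]
    [IsProbabilityMeasure ν] {f : E → ℝ} (h0 : ∀ c, 0 ≤ f c) (h1 : ∀ c, f c ≤ 1) :
    ∫ c, f c ∂μ - ∫ c, f c ∂ν ≤ 1 / 2 * ∑' c, |μ.real {c} - ν.real {c}| := by
  have hi : ∀ (ρ : Measure E) [IsProbabilityMeasure ρ],
      HasSum (fun c => ρ.real {c} * (f c - 1 / 2)) (∫ c, f c ∂ρ - 1 / 2) := by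
    intro ρ _
    have hf : Integrable f ρ := by
      refine Integrable.of_bound (measurable_of_countable f).aestronglyMeasurable 1
        (ae_of_all _ fun c => ?_)
      rw [Real.norm_eq_abs, abs_of_nonneg (h0 c)]
      exact h1 c
    have hg : Integrable (fun c => f c - 1 / 2) ρ := hf.sub (integrable_const _)
    have h := hasSum_integral_measure (μ := fun c => ρ {c} • Measure.dirac c)
      (f := fun c => f c - 1 / 2) (by rwa [Measure.sum_smul_dirac])
    rw [Measure.sum_smul_dirac, integral_sub hf (integrable_const _)] at h
    simp only [integral_smul_measure, integral_dirac, integral_const, probReal_univ, one_mul,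
      smul_eq_mul] at h
    exact h
  have hs := (hi μ).sub (hi ν)
  have ha := (summable_abs_measureReal_sub μ ν).hasSum.mul_left (1 / 2)
  have := hasSum_le (fun c => ?_) hs ha
  · linarith
  · rw [← sub_mul]
    refine (le_abs_self _).trans ?_
    rw [abs_mul, mul_comm]
    refine mul_le_mul_of_nonneg_right ?_ (abs_nonneg _)
    rw [abs_le]
    constructor <;> linarith [h0 c, h1 c]

end Discrete

/-! ### Convergence of discretised total variation distances. -/

section Approximation

/-- If the discretizations `R n (B n x)` converge to `x`, the total variation distances of the
discretized measures converge to the total variation distance. -/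
theorem tendsto_tsum_abs_measureReal_map {S : Type*} [TopologicalSpace S]
    [TopologicalSpace.PseudoMetrizableSpace S] [MeasurableSpace S] [BorelSpace S] (μ ν : Measure S)
    [IsProbabilityMeasure μ] [IsProbabilityMeasure ν] {E : ℕ → Type*}
    [∀ n, MeasurableSpace (E n)] [∀ n, Countable (E n)] [∀ n, MeasurableSingletonClass (E n)]
    (B : ∀ n, S → E n) (hB : ∀ n, Measurable (B n)) (R : ∀ n, E n → S)
    (hR : ∀ x, Tendsto (fun n => R n (B n x)) atTop (𝓝 x)) :
    Tendsto (fun n => 1 / 2 * ∑' c, |(μ.map (B n)).real {c} - (ν.map (B n)).real {c}|) atTop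
      (𝓝 (tvDist μ ν)) := by
  have hpm : ∀ n, IsProbabilityMeasure (μ.map (B n)) := fun n =>
    Measure.isProbabilityMeasure_map (hB n).aemeasurable
  have hpn : ∀ n, IsProbabilityMeasure (ν.map (B n)) := fun n =>
    Measure.isProbabilityMeasure_map (hB n).aemeasurable
  set b : ℕ → ℝ := fun n => 1 / 2 * ∑' c, |(μ.map (B n)).real {c} - (ν.map (B n)).real {c}|
  -- Discretising only restricts the test sets, to unions of cells.
  have hub : ∀ n, b n ≤ tvDist μ ν := by
    intro n
    obtain ⟨C, hC⟩ := hasSum_abs_measureReal_sub (μ.map (B n)) (ν.map (B n))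
    have hm := C.to_countable.measurableSet
    have : b n = μ.real (B n ⁻¹' C) - ν.real (B n ⁻¹' C) := by
      simp only [b]
      rw [hC.tsum_eq, map_measureReal_apply (hB n) hm, map_measureReal_apply (hB n) hm]
      ring
    rw [this]
    exact (le_abs_self _).trans (abs_measureReal_sub_le_tvDist μ ν (hB n hm))
  have hcont : ∀ f : S → ℝ, Continuous f → (∀ x, 0 ≤ f x) → (∀ x, f x ≤ 1) → ∀ ε > 0,
      ∀ᶠ n in atTop, ∫ x, f x ∂μ - ∫ x, f x ∂ν - ε ≤ b n := by
    intro f hf h0 h1 ε hε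
    have hlim : ∀ (ρ : Measure S) [IsProbabilityMeasure ρ],
        Tendsto (fun n => ∫ c, f (R n c) ∂(ρ.map (B n))) atTop (𝓝 (∫ x, f x ∂ρ)) := by
      intro ρ _
      have : ∀ n, ∫ c, f (R n c) ∂(ρ.map (B n)) = ∫ x, f (R n (B n x)) ∂ρ := fun n =>
        integral_map (hB n).aemeasurable
          (measurable_of_countable fun c => f (R n c)).aestronglyMeasurable
      simp_rw [this]
      refine tendsto_integral_of_dominated_convergence (fun _ => 1) (fun n => ?_)
        (integrable_const _) (fun n => ae_of_all _ fun x => ?_) (ae_of_all _ fun x => ?_)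
      · exact ((measurable_of_countable fun c => f (R n c)).comp (hB n)).aestronglyMeasurable
      · rw [Real.norm_eq_abs, abs_of_nonneg (h0 _)]
        exact h1 _
      · exact (hf.tendsto x).comp (hR x)
    have := ((hlim μ).sub (hlim ν)).eventually
      (lt_mem_nhds (sub_lt_self (∫ x, f x ∂μ - ∫ x, f x ∂ν) hε))
    filter_upwards [this] with n hn
    exact hn.le.trans (integral_sub_integral_le_tsum_abs _ _ (fun c => h0 _) fun c => h1 _)
  -- Indicators of closed sets are limits of continuous functions with values in `[0, 1]`, to which
  -- `hcont` applies.
  have hclosed : ∀ F : Set S, IsClosed F → ∀ ε > 0,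
      ∀ᶠ n in atTop, μ.real F - ν.real F - ε ≤ b n := by
    intro F hF ε hε
    have hlim : ∀ (ρ : Measure S) [IsProbabilityMeasure ρ],
        Tendsto (fun k => ∫ x, (hF.apprSeq k x : ℝ) ∂ρ) atTop (𝓝 (ρ.real F)) := by
      intro ρ _
      have h := HasOuterApproxClosed.tendsto_lintegral_apprSeq hF ρ
      refine ((ENNReal.tendsto_toReal (measure_ne_top ρ F)).comp h).congr fun k => ?_
      simp only [Function.comp]
      rw [integral_eq_lintegral_of_nonneg_ae]
      · simp
      · exact ae_of_all _ fun x => NNReal.coe_nonneg _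
      · exact (NNReal.continuous_coe.comp (hF.apprSeq k).continuous).measurable.aestronglyMeasurable
    obtain ⟨k, hk⟩ := (((hlim μ).sub (hlim ν)).eventually
      (lt_mem_nhds (sub_lt_self (μ.real F - ν.real F) (half_pos hε)))).exists
    filter_upwards [hcont (fun x => hF.apprSeq k x)
      (NNReal.continuous_coe.comp (hF.apprSeq k).continuous) (fun x => NNReal.coe_nonneg _)
      (fun x => by exact_mod_cast HasOuterApproxClosed.apprSeq_apply_le_one hF k x) (ε / 2)
      (half_pos hε)] with n hn
    linarith
  have hlb : ∀ ε > 0, ∀ᶠ n in atTop, tvDist μ ν - ε ≤ b n := by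
    intro ε hε
    by_contra hcon
    have hle : tvDist μ ν ≤ tvDist μ ν - ε / 4 := by
      refine tvDist_le μ ν fun C hC => ?_
      -- Inner regularity is needed for `μ` only: shrinking `C` to `F` lowers its `ν`-mass, which is
      -- the favourable direction.
      obtain ⟨F, hFC, hF, hlt⟩ := hC.exists_isClosed_sdiff_lt (μ := μ) (measure_ne_top μ C)
        (ε := ENNReal.ofReal (ε / 4)) (by simpa using hε)
      have h1 : μ.real C ≤ μ.real F + ε / 4 := by
        have h2 : μ.real (C \ F) < ε / 4 := by
          rw [measureReal_def]
          exact (ENNReal.lt_ofReal_iff_toReal_lt (measure_ne_top _ _)).1 hlt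
        have h3 := measureReal_sdiff_add_inter (μ := μ) (s := C) hF.measurableSet
        rw [Set.inter_eq_self_of_subset_right hFC] at h3
        linarith
      have h4 : ν.real F ≤ ν.real C := measureReal_mono hFC
      by_contra hlt2
      refine hcon ?_
      filter_upwards [hclosed F hF (ε / 4) (by linarith)] with n hn
      linarith
    linarith
  refine tendsto_order.2 ⟨fun x hx => ?_, fun x hx => .of_forall fun n => (hub n).trans_lt hx⟩
  filter_upwards [hlb ((tvDist μ ν - x) / 2) (by linarith)] with n hn
  linarith

end Approximation

/-! ### Shift invariance of the law of the whole process. -/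

section Stationarity

variable {Ω : Type*} [MeasurableSpace Ω] {P : Measure Ω} [IsProbabilityMeasure P] {X : ℤ → Ω → ℝ}

/-- Finite-dimensional laws determine the law. Any finite set of times lies in an interval, so its
marginal is a coordinate projection of the law of a block of consecutive times. -/
theorem IsStationary.map_shift_nat (hX : ∀ t, Measurable (X t)) (hs : IsStationary P X) (j : ℕ) :
    P.map (fun ω (k : ℤ) => X (k + j) ω) = P.map (fun ω (k : ℤ) => X k ω) := by
  rw [ProbabilityTheory.map_eq_iff_forall_finset_map_restrict_eq
    (X := fun k ω => X (k + j) ω) (Y := fun k ω => X k ω)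
    (measurable_pi_lambda _ fun _ => hX _).aemeasurable
    (measurable_pi_lambda _ fun _ => hX _).aemeasurable]
  intro I
  obtain ⟨t, ht⟩ := I.bddBelow
  obtain ⟨u, hu⟩ := I.bddAbove
  set i : ℕ := (u - t).toNat
  have hlt : ∀ k : I, ((k : ℤ) - t).toNat < i + 1 := by
    intro k
    have h1 := ht k.2
    have h2 := hu k.2
    omega
  have hto : ∀ k : I, t + (((k : ℤ) - t).toNat : ℤ) = k := by
    intro k
    have h1 := ht k.2
    omega
  set g : (Fin (i + 1) → ℝ) → I → ℝ := fun v k => v ⟨((k : ℤ) - t).toNat, hlt k⟩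
  have hg : Measurable g := measurable_pi_lambda _ fun k => measurable_pi_apply _
  have h := congrArg (Measure.map g) (hs t i j)
  rw [Measure.map_map hg (measurable_pi_lambda _ fun _ => hX _),
    Measure.map_map hg (measurable_pi_lambda _ fun _ => hX _)] at h
  convert h.symm using 2
  · ext ω k
    simp only [g, Function.comp, Finset.restrict]
    rw [add_right_comm t, hto]
  · ext ω k
    simp only [g, Function.comp, Finset.restrict]
    rw [hto]

theorem IsStationary.map_shift (hX : ∀ t, Measurable (X t)) (hs : IsStationary P X) (t : ℤ) :
    P.map (fun ω (k : ℤ) => X (k + t) ω) = P.map (fun ω (k : ℤ) => X k ω) := by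
  obtain ⟨j, rfl | rfl⟩ := t.eq_nat_or_neg
  · exact hs.map_shift_nat hX j
  · have h := hs.map_shift_nat hX j
    have hg : Measurable fun (v : ℤ → ℝ) (k : ℤ) => v (k + -(j : ℤ)) :=
      measurable_pi_lambda _ fun _ => measurable_pi_apply _
    have h := congrArg (Measure.map fun (v : ℤ → ℝ) (k : ℤ) => v (k + -(j : ℤ))) h
    rw [Measure.map_map hg (measurable_pi_lambda _ fun _ => hX _),
      Measure.map_map hg (measurable_pi_lambda _ fun _ => hX _)] at h
    simpa [Function.comp_def] using h.symm

theorem IsStationary.map_comp_shift (hX : ∀ t, Measurable (X t)) (hs : IsStationary P X)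
    {T : Type*} [MeasurableSpace T] {g : (ℤ → ℝ) → T} (hg : Measurable g) (s t : ℤ) :
    P.map (fun ω => g fun k => X (k + s) ω) = P.map (fun ω => g fun k => X (k + t) ω) := by
  have h := congrArg (Measure.map g) ((hs.map_shift hX s).trans (hs.map_shift hX t).symm)
  rwa [Measure.map_map hg (measurable_pi_lambda _ fun _ => hX _),
    Measure.map_map hg (measurable_pi_lambda _ fun _ => hX _)] at h

theorem measurable_past (hX : ∀ t, Measurable (X t)) (t : ℤ) : Measurable (past X t) :=
  measurable_pi_lambda _ fun _ => hX _

theorem measurable_future (hX : ∀ t, Measurable (X t)) (t : ℤ) : Measurable (future X t) :=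
  measurable_pi_lambda _ fun _ => hX _

theorem IsStationary.map_past (hX : ∀ t, Measurable (X t)) (hs : IsStationary P X) (s t : ℤ) :
    P.map (past X s) = P.map (past X t) := by
  have := hs.map_comp_shift hX (g := fun v (k : ℕ) => v (-(k : ℤ)))
    (measurable_pi_lambda _ fun _ => measurable_pi_apply _) s t
  convert this using 2 <;> (ext ω k; simp [past, sub_eq_neg_add])

theorem IsStationary.map_future (hX : ∀ t, Measurable (X t)) (hs : IsStationary P X) (s t : ℤ) :
    P.map (future X s) = P.map (future X t) := by
  have := hs.map_comp_shift hX (g := fun v (k : ℕ) => v (k : ℤ))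
    (measurable_pi_lambda _ fun _ => measurable_pi_apply _) s t
  convert this using 2 <;> (ext ω k; simp [future, add_comm])

theorem IsStationary.map_past_future (hX : ∀ t, Measurable (X t)) (hs : IsStationary P X)
    (a : ℕ) (s t : ℤ) :
    P.map (fun ω => (past X s ω, future X (s + a) ω)) =
      P.map (fun ω => (past X t ω, future X (t + a) ω)) := by
  have := hs.map_comp_shift hX
    (g := fun v => ((fun k : ℕ => v (-(k : ℤ)), fun k : ℕ => v (a + k : ℤ)) :
      (ℕ → ℝ) × (ℕ → ℝ)))
    ((measurable_pi_lambda _ fun _ => measurable_pi_apply _).prodMk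
      (measurable_pi_lambda _ fun _ => measurable_pi_apply _)) s t
  convert this using 2
  · ext ω k
    · simp [past, sub_eq_neg_add]
    · simp only [future]; congr 1; ring
  · ext ω k
    · simp [past, sub_eq_neg_add]
    · simp only [future]; congr 1; ring

/-- The supremum over times runs over a constant family. -/
theorem IsStationary.betaCoeff_eq (hX : ∀ t, Measurable (X t)) (hs : IsStationary P X)
    (a : ℕ) (t : ℤ) :
    betaCoeff P X a = tvDist ((P.map (past X t)).prod (P.map (future X (t + a))))
      (P.map (fun ω => (past X t ω, future X (t + a) ω))) := by
  have : ∀ s : ℤ, tvDist ((P.map (past X s)).prod (P.map (future X (s + a))))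
      (P.map (fun ω => (past X s ω, future X (s + a) ω))) =
      tvDist ((P.map (past X t)).prod (P.map (future X (t + a))))
      (P.map (fun ω => (past X t ω, future X (t + a) ω))) := fun s => by
    rw [hs.map_past hX s t, hs.map_future hX (s + a) (t + a), hs.map_past_future hX a s t]
  rw [betaCoeff]
  simp_rw [this]
  exact ciSup_const

end Stationarity

/-! ### Bin probabilities and the bias. -/

section Bins

theorem measurable_floor_div {α : Type*} [MeasurableSpace α] {f : α → ℝ} (hf : Measurable f)
    (h : ℝ) : Measurable fun x => ⌊f x / h⌋ :=
  Int.measurable_floor.comp (hf.div_const h)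

variable {Ω : Type*} [MeasurableSpace Ω] {P : Measure Ω} [IsProbabilityMeasure P] {X : ℤ → Ω → ℝ}

/-- The bin, in the grid of mesh `h`, of the vector of the values of `x` at the times
`i + 1 + o k`. -/
noncomputable def windowBin {ι : Type*} (h : ℝ) (o : ι → ℕ) (x : ℕ → ℝ) (i : ℕ) : ι → ℤ :=
  fun k => ⌊x (i + 1 + o k) / h⌋

/-- The probability that the first window falls into a given bin. -/
noncomputable def binProb {Ω : Type*} [MeasurableSpace Ω] (P : Measure Ω) (X : ℤ → Ω → ℝ)
    {ι : Type*} (h : ℝ) (o : ι → ℕ) (z : ι → ℤ) : ℝ :=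
  P.real {ω | windowBin h o (fun i => X i ω) 0 = z}

theorem binProb_nonneg {Ω : Type*} [MeasurableSpace Ω] (P : Measure Ω) (X : ℤ → Ω → ℝ)
    {ι : Type*} (h : ℝ) (o : ι → ℕ) (z : ι → ℤ) : 0 ≤ binProb P X h o z :=
  measureReal_nonneg

theorem measurable_windowBin (hX : ∀ t, Measurable (X t)) {ι : Type*} (h : ℝ) (o : ι → ℕ)
    (i : ℕ) : Measurable fun ω => windowBin h o (fun i => X i ω) i :=
  measurable_pi_lambda _ fun _ => measurable_floor_div (hX _) h

theorem IsStationary.measureReal_windowBin_eq (hX : ∀ t, Measurable (X t))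
    (hs : IsStationary P X) {ι : Type*} [Fintype ι] (h : ℝ) (o : ι → ℕ) (i : ℕ) (z : ι → ℤ) :
    P.real {ω | windowBin h o (fun i => X i ω) i = z} = binProb P X h o z := by
  have hg : Measurable fun (v : ℤ → ℝ) (k : ι) => ⌊v (1 + o k : ℤ) / h⌋ :=
    measurable_pi_lambda _ fun k => measurable_floor_div (measurable_pi_apply (1 + o k : ℤ)) h
  have := congrArg (fun μ => μ.real {z}) (hs.map_comp_shift hX hg i 0)
  simp only at this
  rw [map_measureReal_apply (measurable_pi_lambda _ fun _ => measurable_floor_div (hX _) h)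
    (measurableSet_singleton z),
    map_measureReal_apply (measurable_pi_lambda _ fun _ => measurable_floor_div (hX _) h)
    (measurableSet_singleton z)] at this
  rw [binProb]
  convert this using 2
  · ext ω
    simp only [windowBin, Set.mem_ofPred_eq, Set.mem_preimage, Set.mem_singleton_iff, funext_iff]
    refine forall_congr' fun k => ?_
    rw [show (1 : ℤ) + o k + i = ((i + 1 + o k : ℕ) : ℤ) by push_cast; ring]
  · ext ω
    simp only [windowBin, Set.mem_ofPred_eq, Set.mem_preimage, Set.mem_singleton_iff, funext_iff]
    refine forall_congr' fun k => ?_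
    rw [show (1 : ℤ) + o k + 0 = ((0 + 1 + o k : ℕ) : ℤ) by push_cast; ring]

theorem sum_binProb (hX : ∀ t, Measurable (X t)) {ι : Type*} [Fintype ι] (h : ℝ) (o : ι → ℕ)
    (S : Finset (ι → ℤ)) :
    ∑ z ∈ S, binProb P X h o z = P.real {ω | windowBin h o (fun i => X i ω) 0 ∈ S} := by
  have := sum_measureReal_preimage_singleton (μ := P) S
    (f := fun ω => windowBin h o (fun i => X i ω) 0)
    (fun z _ => measurable_windowBin hX h o 0 (measurableSet_singleton z))
  simpa [binProb, Set.preimage] using this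

theorem hasSum_binProb (hX : ∀ t, Measurable (X t)) {ι : Type*} [Fintype ι] (h : ℝ) (o : ι → ℕ) :
    HasSum (binProb P X h o) 1 := by
  have hm := measurable_windowBin hX h o 0
  have := Measure.isProbabilityMeasure_map (μ := P) hm.aemeasurable
  have := hasSum_measureReal_singleton
    (P.map fun ω => windowBin h o (fun i => X i ω) 0) Set.univ
  simp only [Set.indicator_univ, probReal_univ] at this
  convert this using 2 with z
  rw [map_measureReal_apply hm (measurableSet_singleton z)]
  rfl

/-- The offsets of the pair of windows of length `d` at lag `a`. -/
def pairOffset (d a : ℕ) : Fin d ⊕ Fin d → ℕ := Sum.elim (fun k => k) (fun k => d + a - 1 + k)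

/-- The discretization, with mesh `h`, of the last `d` values of a past and the first `d` values
of a future. -/
noncomputable def binPair (d : ℕ) (h : ℝ) (p : (ℕ → ℝ) × (ℕ → ℝ)) :
    (Fin d → ℤ) × (Fin d → ℤ) :=
  (fun k => ⌊p.1 (d - 1 - k) / h⌋, fun k => ⌊p.2 k / h⌋)

theorem measurable_binPair (d : ℕ) (h : ℝ) : Measurable (binPair d h) := by
  refine Measurable.prodMk (measurable_pi_lambda _ fun k => ?_) (measurable_pi_lambda _ fun k => ?_)
  · exact measurable_floor_div
      ((measurable_pi_apply (d - 1 - (k : ℕ))).comp (measurable_fst (β := ℕ → ℝ))) h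
  · exact measurable_floor_div
      ((measurable_pi_apply (k : ℕ)).comp (measurable_snd (α := ℕ → ℝ))) h

theorem tendsto_mul_floor_div {h : ℕ → ℝ} (hpos : ∀ᶠ n in atTop, 0 < h n)
    (h0 : Tendsto h atTop (𝓝 0)) (x : ℝ) :
    Tendsto (fun n => h n * ⌊x / h n⌋) atTop (𝓝 x) := by
  have hl : Tendsto (fun n => x - h n) atTop (𝓝 x) := by simpa using tendsto_const_nhds.sub h0
  refine tendsto_of_tendsto_of_tendsto_of_le_of_le' hl tendsto_const_nhds ?_ ?_
  · filter_upwards [hpos] with n hn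
    have := (Int.lt_floor_add_one (x / h n)).le
    rw [div_le_iff₀ hn] at this
    linarith
  · filter_upwards [hpos] with n hn
    have := Int.floor_le (x / h n)
    rw [le_div_iff₀ hn] at this
    linarith

theorem binProb_pairOffset (hX : ∀ t, Measurable (X t)) (hs : IsStationary P X) {a : ℕ}
    (ha : 0 < a) (d : ℕ) (h : ℝ) (c : (Fin d → ℤ) × (Fin d → ℤ)) :
    ((P.map fun ω => (past X 0 ω, future X (0 + a) ω)).map (binPair d h)).real {c} =
      binProb P X h (pairOffset d a) (Sum.elim c.1 c.2) := by
  -- At time `d` the last `d` values of the past, read backwards, are `X_1, …, X_d`, and the future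
  -- starts at `X_{d+a}`: exactly the first pair of windows.
  rw [hs.map_past_future hX a 0 d, map_measureReal_apply (measurable_binPair d h)
    (measurableSet_singleton c), map_measureReal_apply
    ((measurable_past hX _).prodMk (measurable_future hX _))
    (measurable_binPair d h (measurableSet_singleton c)), binProb]
  congr 1
  ext ω
  simp only [Set.mem_preimage, Set.mem_singleton_iff, Set.mem_ofPred_eq, binPair, windowBin,
    past, future, pairOffset, Prod.ext_iff, funext_iff, Sum.forall, Sum.elim_inl, Sum.elim_inr]
  refine and_congr (forall_congr' fun k => ?_) (forall_congr' fun k => ?_)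
  · rw [show (d : ℤ) - ((d - 1 - (k : ℕ) : ℕ) : ℤ) = ((0 + 1 + (k : ℕ) : ℕ) : ℤ) by omega]
  · rw [show (d : ℤ) + a + (k : ℕ) = ((0 + 1 + (d + a - 1 + (k : ℕ)) : ℕ) : ℤ) by omega]

theorem binProb_mul_binProb (hX : ∀ t, Measurable (X t)) (hs : IsStationary P X) (a : ℕ) (d : ℕ)
    (h : ℝ) (c : (Fin d → ℤ) × (Fin d → ℤ)) :
    (((P.map (past X 0)).prod (P.map (future X (0 + a)))).map (binPair d h)).real {c} =
      binProb P X h (fun k : Fin d => (k : ℕ)) c.1 *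
        binProb P X h (fun k : Fin d => (k : ℕ)) c.2 := by
  -- Under the product law the two marginals may be shifted independently, so that both read the
  -- window `X_1, …, X_d`.
  rw [hs.map_past hX 0 d, hs.map_future hX (0 + a) 1, map_measureReal_apply
    (measurable_binPair d h) (measurableSet_singleton c)]
  have hm : ∀ (b : Fin d → ℤ) (f : Fin d → ℕ),
      MeasurableSet {u : ℕ → ℝ | (fun k => ⌊u (f k) / h⌋) = b} := fun b f =>
    (measurable_pi_lambda _ fun k => measurable_floor_div (measurable_pi_apply (f k)) h)
      (measurableSet_singleton b)
  have : binPair d h ⁻¹' {c} = {u | (fun k : Fin d => ⌊u (d - 1 - k) / h⌋) = c.1} ×ˢ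
      {u | (fun k : Fin d => ⌊u k / h⌋) = c.2} := by
    ext p
    simp [binPair, Prod.ext_iff]
  rw [this, measureReal_prod_prod, map_measureReal_apply (measurable_past hX _) (hm _ _),
    map_measureReal_apply (measurable_future hX _) (hm _ _), binProb, binProb]
  congr 2
  · ext ω
    simp only [Set.mem_preimage, Set.mem_ofPred_eq, windowBin, past, funext_iff]
    refine forall_congr' fun k => ?_
    rw [show (d : ℤ) - ((d - 1 - (k : ℕ) : ℕ) : ℤ) = ((0 + 1 + (k : ℕ) : ℕ) : ℤ) by omega]
-- Convergence in the product topology is coordinatewise: a fixed coordinate is recorded as soon as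
-- `d` exceeds it, with error at most `h`.
theorem tendsto_half_tsum_binProb (hX : ∀ t, Measurable (X t))
    (hs : IsStationary P X) {a : ℕ}
    (ha : 0 < a) {d : ℕ → ℕ} (hd : Tendsto d atTop atTop) {h : ℕ → ℝ}
    (hpos : ∀ᶠ n in atTop, 0 < h n) (h0 : Tendsto h atTop (𝓝 0)) :
    Tendsto (fun n => 1 / 2 * ∑' c : (Fin (d n) → ℤ) × (Fin (d n) → ℤ),
      |binProb P X (h n) (pairOffset (d n) a) (Sum.elim c.1 c.2) -
        binProb P X (h n) (fun k : Fin (d n) => (k : ℕ)) c.1 *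
          binProb P X (h n) (fun k : Fin (d n) => (k : ℕ)) c.2|) atTop
      (𝓝 (betaCoeff P X a)) := by
  have := Measure.isProbabilityMeasure_map (μ := P) (measurable_past hX 0).aemeasurable
  have := Measure.isProbabilityMeasure_map (μ := P) (measurable_future hX (0 + a)).aemeasurable
  have := Measure.isProbabilityMeasure_map (μ := P)
    ((measurable_past hX 0).prodMk (measurable_future hX (0 + a))).aemeasurable
  rw [hs.betaCoeff_eq hX a 0]
  have key := tendsto_tsum_abs_measureReal_map
    ((P.map (past X 0)).prod (P.map (future X (0 + a))))
    (P.map fun ω => (past X 0 ω, future X (0 + a) ω))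
    (fun n => binPair (d n) (h n)) (fun n => measurable_binPair (d n) (h n))
    -- The reconstruction takes the lower corner of the cell and puts `0` in the unrecorded
    -- coordinates; the past is indexed backwards.
    (fun n c => (fun k => if hk : k < d n then h n * c.1 ⟨d n - 1 - k, by omega⟩ else 0,
      fun k => if hk : k < d n then h n * c.2 ⟨k, hk⟩ else 0)) ?_
  · refine key.congr fun n => ?_
    congr 1
    refine tsum_congr fun c => ?_
    rw [binProb_pairOffset hX hs ha, binProb_mul_binProb hX hs, abs_sub_comm]
  · intro p
    refine Tendsto.prodMk_nhds (tendsto_pi_nhds.2 fun k => ?_) (tendsto_pi_nhds.2 fun k => ?_)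
    · refine (tendsto_mul_floor_div hpos h0 (p.1 k)).congr' ?_
      filter_upwards [hd.eventually_gt_atTop k] with n hn
      simp only [hn, dif_pos, binPair]
      rw [show d n - 1 - (d n - 1 - k) = k by omega]
    · refine (tendsto_mul_floor_div hpos h0 (p.2 k)).congr' ?_
      filter_upwards [hd.eventually_gt_atTop k] with n hn
      simp only [hn, dif_pos, binPair]

end Bins

/-! ### The estimator in terms of bin frequencies. -/

section Histogram

/-- The proportion of the first `N` windows that fall into a given bin. -/
noncomputable def binFreq {ι : Type*} [Fintype ι] (h : ℝ) (o : ι → ℕ) (N : ℕ) (x : ℕ → ℝ)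
    (z : ι → ℤ) : ℝ :=
  ((Finset.range N).filter fun i => windowBin h o x i = z).card / N

theorem binFreq_nonneg {ι : Type*} [Fintype ι] (h : ℝ) (o : ι → ℕ) (N : ℕ) (x : ℕ → ℝ)
    (z : ι → ℤ) : 0 ≤ binFreq h o N x z := by
  unfold binFreq
  positivity

theorem binFreq_eq_sum {ι : Type*} [Fintype ι] (h : ℝ) (o : ι → ℕ) (N : ℕ) (x : ℕ → ℝ)
    (z : ι → ℤ) :
    binFreq h o N x z = (∑ i ∈ Finset.range N, if windowBin h o x i = z then 1 else 0) / N := by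
  rw [binFreq, Finset.card_filter]
  push_cast
  rfl

theorem hasSum_binFreq {ι : Type*} [Fintype ι] (h : ℝ) (o : ι → ℕ) {N : ℕ} (hN : 0 < N)
    (x : ℕ → ℝ) : HasSum (binFreq h o N x) 1 := by
  have h1 : HasSum (fun z => ∑ i ∈ Finset.range N, if windowBin h o x i = z then (1 : ℝ) else 0)
      (∑ i ∈ Finset.range N, 1) := by
    refine hasSum_sum fun i _ => ?_
    simpa [eq_comm] using hasSum_ite_eq (windowBin h o x i) (1 : ℝ)
  have h2 := h1.div_const (N : ℝ)
  have hN' : (N : ℝ) ≠ 0 := by positivity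
  simp only [Finset.sum_const, Finset.card_range, nsmul_eq_mul, mul_one, div_self hN'] at h2
  exact h2.congr_fun fun z => binFreq_eq_sum h o N x z

theorem finite_support_binFreq {ι : Type*} [Fintype ι] (h : ℝ) (o : ι → ℕ) (N : ℕ)
    (x : ℕ → ℝ) : (Function.support (binFreq h o N x)).Finite := by
  refine (((Finset.range N).image (windowBin h o x)).finite_toSet).subset fun z hz => ?_
  by_contra hcon
  refine hz ?_
  rw [binFreq, Finset.filter_eq_empty_iff.2]
  · simp
  · intro i hi hiz
    exact hcon (by simpa using ⟨i, by simpa using hi, hiz⟩)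

theorem histogram_window {ι : Type*} [Fintype ι] (h : ℝ) (o : ι → ℕ) (N : ℕ) (x : ℕ → ℝ)
    (y : ι → ℝ) :
    histogram h N (fun i k => x (i + 1 + o k)) y =
      binFreq h o N x (fun k => ⌊y k / h⌋) / h ^ Fintype.card ι := by
  rw [histogram, binFreq, div_div]
  simp only [windowBin, funext_iff]

theorem floor_div_eq_iff {h : ℝ} (hh : 0 < h) (y : ℝ) (m : ℤ) :
    ⌊y / h⌋ = m ↔ y ∈ Set.Ico (m * h) ((m + 1) * h) := by
  rw [Int.floor_eq_iff, le_div_iff₀ hh, div_lt_iff₀ hh, Set.mem_Ico]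

theorem volume_cell {ι : Type*} [Fintype ι] {h : ℝ} (hh : 0 < h) (z : ι → ℤ) :
    volume {y : ι → ℝ | (fun k => ⌊y k / h⌋) = z} = ENNReal.ofReal (h ^ Fintype.card ι) := by
  have : {y : ι → ℝ | (fun k => ⌊y k / h⌋) = z} =
      Set.pi Set.univ fun k => Set.Ico (z k * h) ((z k + 1) * h) := by
    ext y
    simp only [Set.mem_ofPred_eq, funext_iff, floor_div_eq_iff hh, Set.mem_pi, Set.mem_univ,
      true_implies]
  rw [this, Real.volume_pi_Ico, ENNReal.ofReal_pow hh.le, ← Finset.card_univ,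
    ← Finset.prod_const]
  refine Finset.prod_congr rfl fun k _ => ?_
  congr 1
  ring

/-- The integral of a function that is constant on the cells of a grid is a sum over the cells. -/
theorem integral_comp_bins {ι : Type*} [Fintype ι] {h : ℝ} (hh : 0 < h)
    (g : (ι → ℤ) × (ι → ℤ) → ℝ) (hg : (Function.support g).Finite) :
    ∫ p : (ι → ℝ) × (ι → ℝ), g (fun k => ⌊p.1 k / h⌋, fun k => ⌊p.2 k / h⌋) =
      (h ^ Fintype.card ι * h ^ Fintype.card ι) * ∑' c, g c := by
  classical
  set B : (ι → ℝ) × (ι → ℝ) → (ι → ℤ) × (ι → ℤ) :=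
    fun p => (fun k => ⌊p.1 k / h⌋, fun k => ⌊p.2 k / h⌋)
  have hB : Measurable B := by
    refine Measurable.prodMk (measurable_pi_lambda _ fun k => ?_)
      (measurable_pi_lambda _ fun k => ?_)
    · exact measurable_floor_div ((measurable_pi_apply k).comp measurable_fst) h
    · exact measurable_floor_div ((measurable_pi_apply k).comp measurable_snd) h
  have hcell : ∀ c, volume (B ⁻¹' {c}) =
      ENNReal.ofReal (h ^ Fintype.card ι * h ^ Fintype.card ι) := by
    intro c
    have : B ⁻¹' {c} = {y : ι → ℝ | (fun k => ⌊y k / h⌋) = c.1} ×ˢ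
        {y : ι → ℝ | (fun k => ⌊y k / h⌋) = c.2} := by
      ext p
      simp [B, Prod.ext_iff]
    rw [this, Measure.volume_eq_prod, Measure.prod_prod, volume_cell hh, volume_cell hh,
      ENNReal.ofReal_mul (by positivity)]
  have hsum : ∀ p, g (B p) = ∑ c ∈ hg.toFinset, (B ⁻¹' {c}).indicator (fun _ => g c) p := by
    intro p
    simp only [Set.indicator_apply, Set.mem_preimage, Set.mem_singleton_iff]
    rw [Finset.sum_ite_eq]
    split_ifs with hp
    · rfl
    · simpa using hp
  change ∫ p, g (B p) = _
  rw [integral_congr_ae (ae_of_all _ hsum), integral_finsetSum,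
    tsum_eq_sum (s := hg.toFinset) (by simp), Finset.mul_sum]
  · refine Finset.sum_congr rfl fun c _ => ?_
    rw [integral_indicator_const _ (hB (measurableSet_singleton c)), measureReal_def, hcell,
      ENNReal.toReal_ofReal (by positivity), smul_eq_mul]
  · intro c _
    refine (integrable_indicator_iff (hB (measurableSet_singleton c))).2 ?_
    refine integrableOn_const ?_
    rw [hcell]
    exact ENNReal.ofReal_ne_top

/-- The integrand is constant on cells of volume `h ^ (2d)`, which is also the normalisation of both
terms in it. Only finitely many cells contribute. -/
theorem betaHat_eq_tsum {h : ℝ} (hh : 0 < h) (d : ℕ) {a : ℕ} (ha : 0 < a) (n : ℕ) (x : ℕ → ℝ) :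
    betaHat h d a n x = 1 / 2 * ∑' c : (Fin d → ℤ) × (Fin d → ℤ),
      |binFreq h (pairOffset d a) (n + 2 - (2 * d + a)) x (Sum.elim c.1 c.2) -
        binFreq h (fun k : Fin d => (k : ℕ)) (n + 1 - d) x c.1 *
          binFreq h (fun k : Fin d => (k : ℕ)) (n + 1 - d) x c.2| := by
  set f2 := binFreq h (pairOffset d a) (n + 2 - (2 * d + a)) x
  set f1 := binFreq h (fun k : Fin d => (k : ℕ)) (n + 1 - d) x
  have hD : ∀ y, histD h d n x y = f1 (fun k => ⌊y k / h⌋) / h ^ d := fun y => by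
    rw [histD, histogram_window, Fintype.card_fin]
  have hP : ∀ y : Fin d ⊕ Fin d → ℝ, histPair h d a n x y =
      f2 (fun k => ⌊y k / h⌋) / (h ^ d * h ^ d) := fun y => by
    have := histogram_window h (pairOffset d a) (n + 2 - (2 * d + a)) x y
    rw [Fintype.card_sum, Fintype.card_fin, pow_add] at this
    rw [← this, histPair]
    congr 1
    ext i k
    rcases k with k | k
    · rfl
    · simp only [Sum.elim_inr, pairOffset]
      congr 1
      omega
  have hs : (Function.support fun c : (Fin d → ℤ) × (Fin d → ℤ) =>
      |f2 (Sum.elim c.1 c.2) - f1 c.1 * f1 c.2|).Finite := by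
    have h2 := (finite_support_binFreq h (pairOffset d a) (n + 2 - (2 * d + a)) x).preimage
      (Equiv.sumArrowEquivProdArrow (Fin d) (Fin d) ℤ).symm.injective.injOn
    have h1 := finite_support_binFreq h (fun k : Fin d => (k : ℕ)) (n + 1 - d) x
    refine (h2.union (h1.prod h1)).subset fun c hc => ?_
    by_contra hcon
    simp only [Set.mem_union, Set.mem_preimage, Function.mem_support, Set.mem_prod, not_or,
      not_and_or, not_not] at hcon
    refine hc ?_
    have h3 : f2 (Sum.elim c.1 c.2) = 0 := hcon.1
    have h4 : f1 c.1 * f1 c.2 = 0 := mul_eq_zero.2 hcon.2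
    simp [h3, h4]
  have hpos : 0 < h ^ d * h ^ d := by positivity
  have key := integral_comp_bins hh _ hs
  rw [Fintype.card_fin] at key
  rw [betaHat]
  congr 1
  have : ∀ p : (Fin d → ℝ) × (Fin d → ℝ),
      |histPair h d a n x (Sum.elim p.1 p.2) - histD h d n x p.1 * histD h d n x p.2| =
      (h ^ d * h ^ d)⁻¹ * |f2 (Sum.elim (fun k => ⌊p.1 k / h⌋) (fun k => ⌊p.2 k / h⌋)) -
        f1 (fun k => ⌊p.1 k / h⌋) * f1 (fun k => ⌊p.2 k / h⌋)| := fun p => by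
    rw [hP, hD, hD, div_mul_div_comm, ← sub_div, abs_div, abs_of_pos hpos, div_eq_inv_mul]
    congr 5
    ext k
    rcases k with k | k <;> rfl
  simp_rw [this]
  rw [integral_const_mul, key, inv_mul_cancel_left₀ hpos.ne']

end Histogram

/-! ### Deterministic ℓ¹ inequalities. -/

section SummableBounds

/-- Off `S`, bound `|p - q|` by `p + q`. As both masses are one, the mass of `p` off `S` exceeds
that of `q` by at most the ℓ¹ distance on `S`, so no separate tail bound for the random `p` is
needed. -/
theorem tsum_abs_sub_le {E : Type*} {p q : E → ℝ} (hp : HasSum p 1) (hq : HasSum q 1)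
    (hp0 : ∀ z, 0 ≤ p z) (hq0 : ∀ z, 0 ≤ q z) (S : Finset E) :
    ∑' z, |p z - q z| ≤ 2 * ∑ z ∈ S, |p z - q z| + 2 * (1 - ∑ z ∈ S, q z) := by
  have hs : Summable fun z => |p z - q z| := (hp.summable.sub hq.summable).abs
  have hpc := hp.summable.sum_add_tsum_compl (s := S)
  have hqc := hq.summable.sum_add_tsum_compl (s := S)
  rw [hp.tsum_eq] at hpc
  rw [hq.tsum_eq] at hqc
  rw [← hs.sum_add_tsum_compl (s := S)]
  have h1 : ∑' z : ↑((S : Set E)ᶜ), |p z - q z| ≤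
      ∑' z : ↑((S : Set E)ᶜ), p z + ∑' z : ↑((S : Set E)ᶜ), q z := by
    have h := (hp.summable.subtype ((S : Set E)ᶜ)).tsum_add (hq.summable.subtype ((S : Set E)ᶜ))
    simp only [Function.comp_apply] at h
    refine le_of_le_of_eq ?_ h
    refine (hs.subtype _).tsum_le_tsum (fun z => ?_)
      ((hp.summable.subtype _).add (hq.summable.subtype _))
    rw [abs_le]
    constructor <;> linarith [hp0 z, hq0 z]
  have h2 : ∑ z ∈ S, q z - ∑ z ∈ S, p z ≤ ∑ z ∈ S, |p z - q z| := by
    rw [← Finset.sum_sub_distrib]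
    exact Finset.sum_le_sum fun z _ => by rw [abs_sub_comm]; exact le_abs_self _
  linarith

/-- Replace one factor at a time: `p p' - q q' = (p - q) p' + q (p' - q')`. -/
theorem tsum_abs_mul_sub_mul_le {E : Type*} {p q : E → ℝ} (hp : HasSum p 1) (hq : HasSum q 1)
    (hp0 : ∀ z, 0 ≤ p z) (hq0 : ∀ z, 0 ≤ q z) :
    (Summable fun c : E × E => |p c.1 * p c.2 - q c.1 * q c.2|) ∧
      ∑' c : E × E, |p c.1 * p c.2 - q c.1 * q c.2| ≤ 2 * ∑' z, |p z - q z| := by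
  have hs : Summable fun z => |p z - q z| := (hp.summable.sub hq.summable).abs
  have h1 := hs.mul_of_nonneg hp.summable (fun _ => abs_nonneg _) hp0
  have h2 := hq.summable.mul_of_nonneg hs hq0 (fun _ => abs_nonneg _)
  have hle : ∀ c : E × E, |p c.1 * p c.2 - q c.1 * q c.2| ≤
      |p c.1 - q c.1| * p c.2 + q c.1 * |p c.2 - q c.2| := fun c => by
    rw [show p c.1 * p c.2 - q c.1 * q c.2 =
      (p c.1 - q c.1) * p c.2 + q c.1 * (p c.2 - q c.2) by ring]
    refine (abs_add_le _ _).trans_eq ?_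
    rw [abs_mul, abs_mul, abs_of_nonneg (hp0 _), abs_of_nonneg (hq0 _)]
  have hsum : Summable fun c : E × E => |p c.1 * p c.2 - q c.1 * q c.2| :=
    .of_nonneg_of_le (fun _ => abs_nonneg _) hle (h1.add h2)
  refine ⟨hsum, (hsum.tsum_le_tsum hle (h1.add h2)).trans_eq ?_⟩
  rw [h1.tsum_add h2, ← hs.tsum_mul_tsum hp.summable h1, ← hq.summable.tsum_mul_tsum hs h2,
    hp.tsum_eq, hq.tsum_eq]
  ring

/-- The total variation distance between a bivariate law and the product of univariate laws is
Lipschitz. -/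
theorem abs_half_tsum_sub_half_tsum_le {ι : Type*} {p q : (ι → ℤ) → ℝ}
    {p' q' : (ι ⊕ ι → ℤ) → ℝ} (hp : HasSum p 1) (hq : HasSum q 1)
    (hp' : HasSum p' 1) (hq' : HasSum q' 1)
    (hp0 : ∀ z, 0 ≤ p z) (hq0 : ∀ z, 0 ≤ q z) :
    |1 / 2 * ∑' c : (ι → ℤ) × (ι → ℤ), |p' (Sum.elim c.1 c.2) - p c.1 * p c.2| -
      (1 / 2 * ∑' c : (ι → ℤ) × (ι → ℤ), |q' (Sum.elim c.1 c.2) - q c.1 * q c.2|)| ≤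
      1 / 2 * ∑' z, |p' z - q' z| + ∑' z, |p z - q z| := by
  set e := (Equiv.sumArrowEquivProdArrow ι ι ℤ).symm
  have he : ∀ c, e c = Sum.elim c.1 c.2 := fun c => rfl
  simp_rw [← he]
  have hs' : Summable fun z => |p' z - q' z| := (hp'.summable.sub hq'.summable).abs
  have hs2 : Summable fun c => |p' (e c) - q' (e c)| := e.summable_iff.2 hs'
  obtain ⟨hs1, hle1⟩ := tsum_abs_mul_sub_mul_le hp hq hp0 hq0
  have hpe : Summable fun c => p' (e c) := e.summable_iff.2 hp'.summable
  have hqe : Summable fun c => q' (e c) := e.summable_iff.2 hq'.summable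
  have hpp := hp.summable.mul_of_nonneg hp.summable hp0 hp0
  have hqq := hq.summable.mul_of_nonneg hq.summable hq0 hq0
  have ha : Summable fun c => |p' (e c) - p c.1 * p c.2| := (hpe.sub hpp).abs
  have hb : Summable fun c => |q' (e c) - q c.1 * q c.2| := (hqe.sub hqq).abs
  rw [← mul_sub, ← ha.tsum_sub hb, abs_mul, abs_of_pos (by norm_num : (0 : ℝ) < 1 / 2),
    ← e.tsum_eq fun z => |p' z - q' z|]
  have hab := (ha.sub hb).norm
  have h3 : |∑' c, (|p' (e c) - p c.1 * p c.2| - |q' (e c) - q c.1 * q c.2|)| ≤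
      ∑' c, |p' (e c) - q' (e c)| + ∑' c : (ι → ℤ) × (ι → ℤ), |p c.1 * p c.2 - q c.1 * q c.2| := by
    rw [← hs2.tsum_add hs1]
    rw [← Real.norm_eq_abs]
    refine (norm_tsum_le_tsum_norm hab).trans (hab.tsum_le_tsum (fun c => ?_) (hs2.add hs1))
    rw [Real.norm_eq_abs]
    refine (abs_abs_sub_abs_le_abs_sub _ _).trans ?_
    rw [show p' (e c) - p c.1 * p c.2 - (q' (e c) - q c.1 * q c.2) =
      (p' (e c) - q' (e c)) - (p c.1 * p c.2 - q c.1 * q c.2) by ring]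
    exact abs_sub _ _
  linarith

end SummableBounds

/-! ### Sums of conditionally centred indicators. -/

section CondExp

variable {Ω : Type*} {G : MeasurableSpace Ω} [m0 : MeasurableSpace Ω] {P : Measure Ω}
  [IsProbabilityMeasure P]

/-- The indicator of `A`, centred by its conditional probability given `G`. -/
noncomputable def centred {Ω : Type*} (G : MeasurableSpace Ω) [MeasurableSpace Ω] (P : Measure Ω)
    (A : Set Ω) : Ω → ℝ :=
  A.indicator (fun _ => 1) - P[A.indicator (fun _ => (1 : ℝ))|G]

theorem integrable_indicator_one {A : Set Ω} (hA : MeasurableSet A) :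
    Integrable (A.indicator fun _ => (1 : ℝ)) P :=
  (integrable_const 1).indicator hA

theorem condExp_indicator_mem_Icc (hG : G ≤ m0) {A : Set Ω}
    (hA : MeasurableSet A) :
    ∀ᵐ ω ∂P, (P[A.indicator (fun _ => (1 : ℝ))|G]) ω ∈ Set.Icc (0 : ℝ) 1 := by
  have h0 : ∀ᵐ ω ∂P, 0 ≤ (P[A.indicator (fun _ => (1 : ℝ))|G]) ω :=
    condExp_nonneg (ae_of_all _ fun ω => Set.indicator_nonneg (fun _ _ => zero_le_one) ω)
  have h1 : P[A.indicator (fun _ => (1 : ℝ))|G] ≤ᵐ[P] P[fun _ => (1 : ℝ)|G] :=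
    condExp_mono (integrable_indicator_one hA) (integrable_const 1)
      (ae_of_all _ fun ω => Set.indicator_le_self' (fun _ _ => zero_le_one) ω)
  rw [condExp_const hG] at h1
  filter_upwards [h0, h1] with ω h0 h1 using ⟨h0, h1⟩

theorem abs_centred_le_one (hG : G ≤ m0) {A : Set Ω}
    (hA : MeasurableSet A) : ∀ᵐ ω ∂P, |centred G P A ω| ≤ 1 := by
  filter_upwards [condExp_indicator_mem_Icc (P := P) hG hA] with ω hω
  simp only [centred, Pi.sub_apply]
  by_cases h : ω ∈ A <;> simp only [h, Set.indicator_of_mem, Set.indicator_of_notMem,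
    not_false_eq_true] <;> rw [abs_le] <;> constructor <;> linarith [hω.1, hω.2]

theorem integrable_centred {A : Set Ω} (hA : MeasurableSet A) :
    Integrable (centred G P A) P :=
  (integrable_indicator_one hA).sub integrable_condExp

theorem integrable_mul_centred (hG : G ≤ m0) {A : Set Ω}
    (hA : MeasurableSet A) {f : Ω → ℝ} (hf : Integrable f P) :
    Integrable (fun ω => f ω * centred G P A ω) P :=
  hf.mul_bdd (integrable_centred hA).aestronglyMeasurable (abs_centred_le_one hG hA)

/-- A centred indicator is orthogonal to everything known beforehand. -/
theorem integral_mul_centred (hG : G ≤ m0) {A : Set Ω}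
    (hA : MeasurableSet A) {f : Ω → ℝ} (hfG : StronglyMeasurable[G] f) (hf : Integrable f P) :
    ∫ ω, f ω * centred G P A ω ∂P = 0 := by
  rw [← integral_condExp hG]
  have h := condExp_mul_of_stronglyMeasurable_left hfG (integrable_mul_centred hG hA hf)
    (integrable_centred (P := P) (G := G) hA)
  have h2 : P[centred G P A|G] =ᵐ[P] 0 := by
    have h3 := condExp_sub (integrable_indicator_one (P := P) hA)
      (integrable_condExp (μ := P) (m := G) (f := A.indicator fun _ => (1 : ℝ))) G
    refine h3.trans ?_
    rw [condExp_of_stronglyMeasurable hG stronglyMeasurable_condExp integrable_condExp, sub_self]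
  refine integral_eq_zero_of_ae ?_
  filter_upwards [h, h2] with ω h h2
  change (P[f * centred G P A|G]) ω = 0
  rw [h, Pi.mul_apply, h2, Pi.zero_apply, mul_zero]

theorem integral_centred_sq_le (hG : G ≤ m0) {A : Set Ω}
    (hA : MeasurableSet A) : ∫ ω, centred G P A ω * centred G P A ω ∂P ≤ P.real A := by
  have h1 := integrable_mul_centred hG hA (integrable_indicator_one (P := P) hA)
  have h2 := integrable_mul_centred hG hA
    (integrable_condExp (μ := P) (m := G) (f := A.indicator fun _ => (1 : ℝ)))
  have h3 := integral_mul_centred hG hA stronglyMeasurable_condExp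
    (integrable_condExp (μ := P) (m := G) (f := A.indicator fun _ => (1 : ℝ)))
  calc ∫ ω, centred G P A ω * centred G P A ω ∂P
      = ∫ ω, (A.indicator (fun _ => (1 : ℝ)) ω * centred G P A ω -
          (P[A.indicator (fun _ => (1 : ℝ))|G]) ω * centred G P A ω) ∂P := by
        refine integral_congr_ae (ae_of_all _ fun ω => ?_)
        simp only [centred, Pi.sub_apply]
        ring
    _ = ∫ ω, A.indicator (fun _ => (1 : ℝ)) ω * centred G P A ω ∂P := by
        rw [integral_sub h1 h2, h3, sub_zero]
    _ ≤ ∫ ω, A.indicator (fun _ => (1 : ℝ)) ω ∂P := by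
        refine integral_mono_ae h1 (integrable_indicator_one hA) ?_
        filter_upwards [condExp_indicator_mem_Icc (P := P) hG hA] with ω hω
        by_cases h : ω ∈ A <;> simp [h, centred, hω.1]
    _ = P.real A := by
        rw [integral_indicator_const _ hA, smul_eq_mul, mul_one]

end CondExp

theorem stronglyMeasurable_centred {Ω : Type*} {G G' : MeasurableSpace Ω} [MeasurableSpace Ω]
    {P : Measure Ω} (hGG' : G ≤ G') {A : Set Ω}
    (hA : MeasurableSet[G'] A) : StronglyMeasurable[G'] (centred G P A) :=
  (stronglyMeasurable_const.indicator hA).sub (stronglyMeasurable_condExp.mono hGG')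

/-- The earlier factor is already known at time `i + m ≤ j`, where the later one has conditional
mean zero. -/
theorem integral_centred_mul_centred_eq_zero
    {Ω : Type*} {G : ℕ → MeasurableSpace Ω} [m0 : MeasurableSpace Ω] {P : Measure Ω}
    [IsProbabilityMeasure P] (hG : ∀ i, G i ≤ m0) (hmono : Monotone G) {A : ℕ → Set Ω} {m : ℕ}
    (hA : ∀ i, MeasurableSet[G (i + m)] (A i))
    {i j : ℕ} (hij : i + m ≤ j) :
    ∫ ω, centred (G i) P (A i) ω * centred (G j) P (A j) ω ∂P = 0 :=
  integral_mul_centred (hG j) (hG _ _ (hA j))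
    (stronglyMeasurable_centred (hmono (by omega)) (hmono hij _ (hA i)))
    (integrable_centred (hG _ _ (hA i)))

theorem integral_centred_mul_centred_le
    {Ω : Type*} {G : ℕ → MeasurableSpace Ω} [m0 : MeasurableSpace Ω] {P : Measure Ω}
    [IsProbabilityMeasure P] (hG : ∀ i, G i ≤ m0) {A : ℕ → Set Ω} {m : ℕ}
    (hA : ∀ i, MeasurableSet[G (i + m)] (A i)) {p : ℝ}
    (hp : ∀ i, P.real (A i) = p)
    (i j : ℕ) :
    ∫ ω, centred (G i) P (A i) ω * centred (G j) P (A j) ω ∂P ≤ p := by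
  have hA' := fun i => hG _ _ (hA i)
  have hsq := fun i => integrable_mul_centred (hG i) (hA' i)
    (integrable_centred (P := P) (G := G i) (hA' i))
  have h1 := integral_centred_sq_le (P := P) (hG i) (hA' i)
  have h2 := integral_centred_sq_le (P := P) (hG j) (hA' j)
  rw [hp] at h1 h2
  have h3 := integral_mono (integrable_mul_centred (hG j) (hA' j)
    (integrable_centred (P := P) (G := G i) (hA' i)))
    (((hsq i).add (hsq j)).const_mul (1 / 2)) fun ω => by
      simp only [Pi.add_apply]
      nlinarith [sq_nonneg (centred (G i) P (A i) ω - centred (G j) P (A j) ω)]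
  rw [integral_const_mul] at h3
  simp only [Pi.add_apply] at h3
  rw [integral_add (hsq i) (hsq j)] at h3
  linarith

/-- Expanding the square, each index `i` has at most `2m` partners `j` with `|i - j| < m`, each
contributing at most `p`; all other pairs are orthogonal. -/
theorem integral_sq_sum_centred_le
    {Ω : Type*} {G : ℕ → MeasurableSpace Ω} [m0 : MeasurableSpace Ω] {P : Measure Ω}
    [IsProbabilityMeasure P] (hG : ∀ i, G i ≤ m0) (hmono : Monotone G) {A : ℕ → Set Ω} {m : ℕ}
    (hA : ∀ i, MeasurableSet[G (i + m)] (A i)) {p : ℝ}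
    (hp : ∀ i, P.real (A i) = p)
    (N : ℕ) :
    ∫ ω, (∑ i ∈ Finset.range N, centred (G i) P (A i) ω) ^ 2 ∂P ≤ 2 * m * N * p := by
  have hA' := fun i => hG _ _ (hA i)
  have hp0 : 0 ≤ p := hp 0 ▸ measureReal_nonneg
  have hint := fun i j => integrable_mul_centred (hG j) (hA' j)
    (integrable_centred (P := P) (G := G i) (hA' i))
  have hpair : ∀ i j, ∫ ω, centred (G i) P (A i) ω * centred (G j) P (A j) ω ∂P ≤
      if j ∈ Finset.Ico (i + 1 - m) (i + m) then p else 0 := by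
    intro i j
    split_ifs with hj
    · exact integral_centred_mul_centred_le hG hA hp i j
    · rw [Finset.mem_Ico, not_and_or, not_le, not_lt] at hj
      rcases hj with hj | hj
      · simp_rw [mul_comm (centred (G i) P (A i) _)]
        exact (integral_centred_mul_centred_eq_zero hG hmono hA (by omega)).le
      · exact (integral_centred_mul_centred_eq_zero hG hmono hA hj).le
  simp_rw [sq, Finset.sum_mul_sum]
  rw [integral_finsetSum _ fun i _ => integrable_finsetSum _ fun j _ => hint i j]
  simp_rw [integral_finsetSum _ fun j _ => hint _ j]
  calc ∑ i ∈ Finset.range N, ∑ j ∈ Finset.range N,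
        ∫ ω, centred (G i) P (A i) ω * centred (G j) P (A j) ω ∂P
      ≤ ∑ i ∈ Finset.range N, 2 * m * p := by
        refine Finset.sum_le_sum fun i _ => ?_
        refine (Finset.sum_le_sum fun j _ => hpair i j).trans ?_
        rw [← Finset.sum_filter, Finset.sum_const, nsmul_eq_mul]
        refine mul_le_mul_of_nonneg_right ?_ hp0
        have : ((Finset.range N).filter fun j => j ∈ Finset.Ico (i + 1 - m) (i + m)).card ≤
            (Finset.Ico (i + 1 - m) (i + m)).card :=
          Finset.card_le_card fun j hj => (Finset.mem_filter.1 hj).2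
        rw [Nat.card_Ico] at this
        exact_mod_cast this.trans (by omega)
    _ = 2 * m * N * p := by
        rw [Finset.sum_const, Finset.card_range, nsmul_eq_mul]
        ring

/-- Nonnegativity of the variance of `|f|` turns the second moment bound into one for the mean. -/
theorem integral_abs_sum_centred_le
    {Ω : Type*} {G : ℕ → MeasurableSpace Ω} [m0 : MeasurableSpace Ω] {P : Measure Ω}
    [IsProbabilityMeasure P] (hG : ∀ i, G i ≤ m0) (hmono : Monotone G) {A : ℕ → Set Ω} {m : ℕ}
    (hA : ∀ i, MeasurableSet[G (i + m)] (A i)) {p : ℝ}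
    (hp : ∀ i, P.real (A i) = p)
    (N : ℕ) :
    ∫ ω, |∑ i ∈ Finset.range N, centred (G i) P (A i) ω| ∂P ≤ √(2 * m * N * p) := by
  have hA' := fun i => hG _ _ (hA i)
  set f : Ω → ℝ := fun ω => ∑ i ∈ Finset.range N, centred (G i) P (A i) ω
  have hf : Integrable f P := integrable_finsetSum _ fun i _ => integrable_centred (hA' i)
  have hbdd : ∀ᵐ ω ∂P, ‖f ω‖ ≤ N := by
    have := ae_all_iff.2 fun i => abs_centred_le_one (P := P) (hG i) (hA' i)
    filter_upwards [this] with ω hω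
    refine (Finset.abs_sum_le_sum_abs _ _).trans ((Finset.sum_le_sum fun i _ => hω i).trans ?_)
    simp
  have hsq : Integrable (fun ω => |f ω| ^ 2) P := by
    simp_rw [sq_abs, sq]
    exact hf.mul_bdd hf.aestronglyMeasurable hbdd
  have hvar : (∫ ω, |f ω| ∂P) ^ 2 ≤ ∫ ω, |f ω| ^ 2 ∂P := by
    set c := ∫ ω, |f ω| ∂P
    have h : 0 ≤ ∫ ω, (|f ω| - c) ^ 2 ∂P := integral_nonneg fun ω => sq_nonneg (|f ω| - c)
    have h2 : ∀ ω, (|f ω| - c) ^ 2 = |f ω| ^ 2 - 2 * c * |f ω| + c ^ 2 := fun ω => by ring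
    simp_rw [h2] at h
    have hsub : Integrable (fun ω => |f ω| ^ 2 - 2 * c * |f ω|) P := hsq.sub (hf.abs.const_mul _)
    rw [integral_add hsub (integrable_const _), integral_sub hsq (hf.abs.const_mul _),
      integral_const_mul] at h
    simp only [integral_const, probReal_univ, smul_eq_mul, one_mul] at h
    change 0 ≤ _ - 2 * c * c + c ^ 2 at h
    nlinarith
  refine Real.le_sqrt_of_sq_le (hvar.trans ?_)
  simp_rw [sq_abs]
  exact integral_sq_sum_centred_le hG hmono hA hp N

/-! ### Concentration of bin frequencies without a mixing rate. -/

section Concentration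

theorem comap_past_mono {Ω : Type*} {X : ℤ → Ω → ℝ} {s t : ℤ} (hst : s ≤ t) :
    MeasurableSpace.comap (past X s) inferInstance ≤
      MeasurableSpace.comap (past X t) inferInstance := by
  have : past X s = (fun (v : ℕ → ℝ) k => v (k + (t - s).toNat)) ∘ past X t := by
    ext ω k
    simp only [past, Function.comp]
    congr 1
    push_cast
    omega
  rw [this, ← MeasurableSpace.comap_comp]
  refine MeasurableSpace.comap_mono (Measurable.comap_le ?_)
  exact measurable_pi_lambda _ fun k => measurable_pi_apply _

variable {Ω : Type*} [m0 : MeasurableSpace Ω] {P : Measure Ω} [IsProbabilityMeasure P]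
  {X : ℤ → Ω → ℝ}

theorem abs_joint_sub_prod_le_betaCoeff (hX : ∀ t, Measurable (X t)) (t : ℤ) (g : ℕ)
    {C : Set ((ℕ → ℝ) × (ℕ → ℝ))} (hC : MeasurableSet C) :
    |(P.map fun ω => (past X t ω, future X (t + g) ω)).real C -
      ((P.map (past X t)).prod (P.map (future X (t + g)))).real C| ≤ betaCoeff P X g := by
  have hpast : ∀ t, IsProbabilityMeasure (P.map (past X t)) := fun t =>
    Measure.isProbabilityMeasure_map (measurable_past hX t).aemeasurable
  have hfut : ∀ t, IsProbabilityMeasure (P.map (future X t)) := fun t =>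
    Measure.isProbabilityMeasure_map (measurable_future hX t).aemeasurable
  have hjoint : ∀ s t, IsProbabilityMeasure (P.map fun ω => (past X s ω, future X t ω)) :=
    fun s t => Measure.isProbabilityMeasure_map
      ((measurable_past hX s).prodMk (measurable_future hX t)).aemeasurable
  rw [abs_sub_comm]
  refine (abs_measureReal_sub_le_tvDist _ _ hC).trans ?_
  refine le_ciSup (f := fun t : ℤ => tvDist ((P.map (past X t)).prod (P.map (future X (t + g))))
    (P.map (fun ω => (past X t ω, future X (t + g) ω)))) ⟨1, ?_⟩ t
  rintro _ ⟨s, rfl⟩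
  exact tvDist_le_one _ _

/-- The products `A z ×ˢ φ ⁻¹' {z}` are disjoint, so their union is a single test set and the mixing
coefficient is paid once, not once per `z`. -/
theorem sum_measureReal_inter_sub_le (hX : ∀ t, Measurable (X t)) (t : ℤ) (g : ℕ)
    {E : Type*} [MeasurableSpace E] [MeasurableSingletonClass E] {φ : (ℕ → ℝ) → E}
    (hφ : Measurable φ) (S : Finset E) {A : E → Set (ℕ → ℝ)} (hA : ∀ z, MeasurableSet (A z)) :
    ∑ z ∈ S, (P.real (past X t ⁻¹' A z ∩ {ω | φ (future X (t + g) ω) = z}) -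
      P.real (past X t ⁻¹' A z) * P.real {ω | φ (future X (t + g) ω) = z}) ≤
      betaCoeff P X g := by
  have hpast := measurable_past hX t
  have hfut := measurable_future hX (t + g)
  have := Measure.isProbabilityMeasure_map (μ := P) hpast.aemeasurable
  have := Measure.isProbabilityMeasure_map (μ := P) hfut.aemeasurable
  have := Measure.isProbabilityMeasure_map (μ := P) (hpast.prodMk hfut).aemeasurable
  have hz : ∀ z, MeasurableSet (φ ⁻¹' {z}) := fun z => hφ (measurableSet_singleton z)
  have hm : ∀ z ∈ S, MeasurableSet (A z ×ˢ (φ ⁻¹' {z})) := fun z _ => (hA z).prod (hz z)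
  have hd : (S : Set E).PairwiseDisjoint fun z => A z ×ˢ (φ ⁻¹' {z}) := by
    intro z _ w _ hzw
    refine Set.disjoint_left.2 fun p hp hq => hzw ?_
    exact (hp.2 : φ p.2 = z).symm.trans hq.2
  have key := (le_abs_self _).trans
    (abs_joint_sub_prod_le_betaCoeff (P := P) hX t g (S.measurableSet_biUnion hm))
  rw [measureReal_biUnion_finset hd hm, measureReal_biUnion_finset hd hm,
    ← Finset.sum_sub_distrib] at key
  refine (Finset.sum_le_sum fun z hzS => ?_).trans key
  rw [map_measureReal_apply (hpast.prodMk hfut) (hm z hzS), measureReal_prod_prod,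
    map_measureReal_apply hpast (hA z), map_measureReal_apply hfut (hz z)]
  exact le_rfl

/-- In the mean, the conditional law of the future given the past differs from its law by no more
than the mixing coefficient. -/
theorem sum_integral_abs_condExp_sub_le (hX : ∀ t, Measurable (X t)) (t : ℤ) (g : ℕ)
    {E : Type*} [MeasurableSpace E] [MeasurableSingletonClass E] {φ : (ℕ → ℝ) → E}
    (hφ : Measurable φ) (S : Finset E) :
    ∑ z ∈ S, ∫ ω, |(P[{ω | φ (future X (t + g) ω) = z}.indicator (fun _ => (1 : ℝ)) |
      MeasurableSpace.comap (past X t) inferInstance]) ω -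
        P.real {ω | φ (future X (t + g) ω) = z}| ∂P ≤ 2 * betaCoeff P X g := by
  have hpast := measurable_past hX t
  have hfut := measurable_future hX (t + g)
  set Z : E → Set Ω := fun z => {ω | φ (future X (t + g) ω) = z}
  have hZ : ∀ z, MeasurableSet (Z z) := fun z => (hφ.comp hfut) (measurableSet_singleton z)
  set q : E → Ω → ℝ := fun z => P[(Z z).indicator (fun _ => (1 : ℝ)) |
    MeasurableSpace.comap (past X t) inferInstance]
  have hle : MeasurableSpace.comap (past X t) inferInstance ≤ m0 := hpast.comap_le
  -- `A z` collects the pasts for which the conditional probability is at least the unconditional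
  -- one.
  have hset : ∀ z, ∃ A : Set (ℕ → ℝ), MeasurableSet A ∧
      past X t ⁻¹' A = {ω | P.real (Z z) ≤ q z ω} := fun z =>
    (stronglyMeasurable_condExp (m := MeasurableSpace.comap (past X t) inferInstance)).measurable
      (measurableSet_Ici (a := P.real (Z z)))
  choose A hA hAq using hset
  have hqint : ∀ z, Integrable (q z) P := fun z => integrable_condExp
  have hterm : ∀ z, ∫ ω, |q z ω - P.real (Z z)| ∂P =
      2 * (P.real (past X t ⁻¹' A z ∩ Z z) - P.real (past X t ⁻¹' A z) * P.real (Z z)) := by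
    intro z
    have hm := hpast (hA z)
    have hi : Integrable (fun ω => q z ω - P.real (Z z)) P := (hqint z).sub (integrable_const _)
    -- This is `|x| = 2 x⁺ - x`; the last term has mean zero.
    have h1 : ∀ ω, |q z ω - P.real (Z z)| =
        2 * (past X t ⁻¹' A z).indicator (fun ω => q z ω - P.real (Z z)) ω -
          (q z ω - P.real (Z z)) := by
      intro ω
      rw [hAq z]
      by_cases h : P.real (Z z) ≤ q z ω
      · rw [Set.indicator_of_mem (by exact h), abs_of_nonneg (sub_nonneg.2 h)]
        ring
      · rw [Set.indicator_of_notMem (by exact h), abs_of_neg (sub_neg.2 (not_le.1 h))]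
        ring
    have h2 : ∫ ω, (q z ω - P.real (Z z)) ∂P = 0 := by
      rw [integral_sub (hqint z) (integrable_const _), integral_condExp hle,
        integral_indicator_const _ (hZ z)]
      simp
    have h3 : ∫ ω in past X t ⁻¹' A z, q z ω ∂P = P.real (past X t ⁻¹' A z ∩ Z z) := by
      rw [setIntegral_condExp hle (integrable_indicator_one (hZ z)) ⟨A z, hA z, rfl⟩,
        setIntegral_indicator (hZ z)]
      simp
    simp_rw [h1]
    rw [integral_sub ((hi.indicator hm).const_mul 2) hi, h2, integral_const_mul,
      integral_indicator hm, integral_sub (hqint z).integrableOn (integrable_const _), h3]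
    simp
  change ∑ z ∈ S, ∫ ω, |q z ω - P.real (Z z)| ∂P ≤ _
  simp_rw [hterm]
  rw [← Finset.mul_sum]
  have := sum_measureReal_inter_sub_le (P := P) hX t g hφ S hA
  change ∑ z ∈ S, (P.real (past X t ⁻¹' A z ∩ Z z) -
    P.real (past X t ⁻¹' A z) * P.real (Z z)) ≤ betaCoeff P X g at this
  linarith

/-- The bin frequencies of a stationary process are close to the bin probabilities, with no
assumption on the rate of mixing. -/
theorem integral_sum_abs_binFreq_sub_le (hX : ∀ t, Measurable (X t)) (hs : IsStationary P X)
    {ι : Type*} [Fintype ι] (h : ℝ) (o : ι → ℕ) {ℓ : ℕ} (ho : ∀ k, o k ≤ ℓ) {N : ℕ} (hN : 0 < N)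
    (g : ℕ) (S : Finset (ι → ℤ)) :
    ∫ ω, ∑ z ∈ S, |binFreq h o N (fun i => X i ω) z - binProb P X h o z| ∂P ≤
      √(2 * (ℓ + g) * S.card / N) + 2 * betaCoeff P X g := by
  set φ : (ℕ → ℝ) → ι → ℤ := fun v k => ⌊v (o k) / h⌋
  have hφ : Measurable φ :=
    measurable_pi_lambda _ fun k => measurable_floor_div (measurable_pi_apply (o k)) h
  set A : (ι → ℤ) → ℕ → Set Ω := fun z i => {ω | windowBin h o (fun i => X i ω) i = z}
  -- Window `i` starts at time `i + 1`, so conditioning stops `g` steps earlier. The window ends by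
  -- time `i + 1 + ℓ`, hence is known to `G (i + (ℓ + g))`.
  set G : ℕ → MeasurableSpace Ω := fun i =>
    MeasurableSpace.comap (past X (i + 1 - g : ℤ)) inferInstance
  have hG : ∀ i, G i ≤ m0 := fun i => (measurable_past hX _).comap_le
  have hmono : Monotone G := fun i j hij => comap_past_mono (by omega)
  have hA : ∀ z i, MeasurableSet[G (i + (ℓ + g))] (A z i) := by
    intro z i
    refine ⟨{v | (fun k => ⌊v (ℓ - o k) / h⌋) = z}, ?_, ?_⟩
    · exact (measurable_pi_lambda _ fun k =>
        measurable_floor_div (measurable_pi_apply (ℓ - o k)) h) (measurableSet_singleton z)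
    · ext ω
      simp only [A, past, windowBin, Set.mem_preimage, Set.mem_ofPred_eq, funext_iff]
      refine forall_congr' fun k => ?_
      have := ho k
      rw [show ((i + (ℓ + g) : ℕ) : ℤ) + 1 - g - ((ℓ - o k : ℕ) : ℤ) =
        ((i + 1 + o k : ℕ) : ℤ) by push_cast [this]; ring]
  have hAm : ∀ z i, MeasurableSet (A z i) := fun z i => hG _ _ (hA z i)
  have hp : ∀ z i, P.real (A z i) = binProb P X h o z := fun z i =>
    hs.measureReal_windowBin_eq hX h o i z
  set q : (ι → ℤ) → ℕ → Ω → ℝ := fun z i => P[(A z i).indicator (fun _ => (1 : ℝ))|G i]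
  have hN' : (0 : ℝ) < N := by exact_mod_cast hN
  have hmix : ∀ i : ℕ, ∑ z ∈ S, ∫ ω, |q z i ω - binProb P X h o z| ∂P ≤ 2 * betaCoeff P X g := by
    intro i
    have := sum_integral_abs_condExp_sub_le (P := P) hX (i + 1 - g : ℤ) g hφ S
    have hAz : ∀ z, {ω | φ (future X ((i : ℤ) + 1 - g + g) ω) = z} = A z i := by
      intro z
      ext ω
      simp only [A, φ, future, Set.mem_ofPred_eq, sub_add_cancel]
      rfl
    simp_rw [hAz, hp] at this
    exact this
  have hci : ∀ z, Integrable (fun ω => |∑ i ∈ Finset.range N, centred (G i) P (A z i) ω|) P :=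
    fun z => (integrable_finsetSum _ fun i _ => integrable_centred (hAm z i)).abs
  have hqi : ∀ z i, Integrable (fun ω => |q z i ω - binProb P X h o z|) P := fun z i =>
    (integrable_condExp.sub (integrable_const _)).abs
  have hpt : ∀ z ω, |binFreq h o N (fun i => X i ω) z - binProb P X h o z| ≤
      (N : ℝ)⁻¹ * (|∑ i ∈ Finset.range N, centred (G i) P (A z i) ω| +
        ∑ i ∈ Finset.range N, |q z i ω - binProb P X h o z|) := by
    intro z ω
    have : binFreq h o N (fun i => X i ω) z - binProb P X h o z =
        (N : ℝ)⁻¹ * (∑ i ∈ Finset.range N, centred (G i) P (A z i) ω +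
          ∑ i ∈ Finset.range N, (q z i ω - binProb P X h o z)) := by
      rw [← Finset.sum_add_distrib, binFreq_eq_sum]
      have h1 : ∀ i, centred (G i) P (A z i) ω + (q z i ω - binProb P X h o z) =
          (if windowBin h o (fun i => X i ω) i = z then 1 else 0) - binProb P X h o z := by
        intro i
        have : (A z i).indicator (fun _ => (1 : ℝ)) ω =
          if windowBin h o (fun i => X i ω) i = z then 1 else 0 := Set.indicator_apply _ _ _
        rw [← this]
        simp only [centred, Pi.sub_apply, q]
        ring
      simp_rw [h1]
      rw [Finset.sum_sub_distrib, Finset.sum_const, Finset.card_range, nsmul_eq_mul]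
      field_simp
    rw [this, abs_mul, abs_of_pos (inv_pos.2 hN')]
    refine mul_le_mul_of_nonneg_left ?_ (inv_pos.2 hN').le
    exact (abs_add_le _ _).trans (add_le_add_right (Finset.abs_sum_le_sum_abs _ _) _)
  have hri : ∀ z, Integrable (fun ω => (N : ℝ)⁻¹ *
      (|∑ i ∈ Finset.range N, centred (G i) P (A z i) ω| +
        ∑ i ∈ Finset.range N, |q z i ω - binProb P X h o z|)) P := fun z =>
    ((hci z).add (integrable_finsetSum _ fun i _ => hqi z i)).const_mul _
  -- Cauchy–Schwarz, the bin probabilities having sum at most one.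
  have hsqrt : ∑ z ∈ S, √(binProb P X h o z) ≤ √S.card := by
    refine Real.le_sqrt_of_sq_le (sq_sum_le_card_mul_sum_sq.trans ?_)
    simp_rw [Real.sq_sqrt (binProb_nonneg P X h o _)]
    rw [sum_binProb hX]
    exact mul_le_of_le_one_right (Nat.cast_nonneg _) measureReal_le_one
  calc ∫ ω, ∑ z ∈ S, |binFreq h o N (fun i => X i ω) z - binProb P X h o z| ∂P
      ≤ ∫ ω, ∑ z ∈ S, (N : ℝ)⁻¹ * (|∑ i ∈ Finset.range N, centred (G i) P (A z i) ω| +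
        ∑ i ∈ Finset.range N, |q z i ω - binProb P X h o z|) ∂P := by
        refine integral_mono_of_nonneg
          (ae_of_all _ fun ω => Finset.sum_nonneg fun z _ => abs_nonneg _)
          (integrable_finsetSum _ fun z _ => hri z)
          (ae_of_all _ fun ω => Finset.sum_le_sum fun z _ => hpt z ω)
    _ = (N : ℝ)⁻¹ * (∑ z ∈ S, ∫ ω, |∑ i ∈ Finset.range N, centred (G i) P (A z i) ω| ∂P +
        ∑ i ∈ Finset.range N, ∑ z ∈ S, ∫ ω, |q z i ω - binProb P X h o z| ∂P) := by
        rw [integral_finsetSum _ fun z _ => hri z, Finset.sum_comm, ← Finset.sum_add_distrib,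
          Finset.mul_sum]
        refine Finset.sum_congr rfl fun z _ => ?_
        rw [integral_const_mul, integral_add (hci z) (integrable_finsetSum _ fun i _ => hqi z i),
          integral_finsetSum _ fun i _ => hqi z i]
    _ ≤ (N : ℝ)⁻¹ * (√(2 * (ℓ + g) * N) * √S.card + N * (2 * betaCoeff P X g)) := by
        refine mul_le_mul_of_nonneg_left (add_le_add ?_ ?_) (inv_pos.2 hN').le
        · refine le_trans ?_ (mul_le_mul_of_nonneg_left hsqrt (Real.sqrt_nonneg _))
          rw [Finset.mul_sum]
          refine Finset.sum_le_sum fun z _ => ?_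
          refine (integral_abs_sum_centred_le hG hmono (hA z) (hp z) N).trans_eq ?_
          rw [← Real.sqrt_mul (by positivity)]
          push_cast
          rfl
        · refine (Finset.sum_le_sum fun i _ => hmix i).trans_eq ?_
          rw [Finset.sum_const, Finset.card_range, nsmul_eq_mul]
    _ = √(2 * (ℓ + g) * S.card / N) + 2 * betaCoeff P X g := by
        rw [mul_add, inv_mul_cancel_left₀ hN'.ne']
        congr 1
        rw [← Real.sqrt_mul (by positivity), eq_comm, Real.sqrt_eq_iff_mul_self_eq
          (by positivity) (by positivity), mul_mul_mul_comm, Real.mul_self_sqrt (by positivity)]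
        field_simp

end Concentration

/-! ### Counting the relevant bins. -/

section Counting

/-- Each new term is at most the product of the reciprocals of `1 + hR` and `1 + h(R+1)`, which
telescopes; the bound is uniform in `R`. -/
theorem sum_Icc_inv_sq_le {h : ℝ} (hh : 0 < h) (h1 : h ≤ 1) (R : ℕ) :
    ∑ m ∈ Finset.Icc (-(R : ℤ)) R, ((1 + h * |(m : ℝ)|) ^ 2)⁻¹ ≤ 3 / h := by
  have key : ∀ R : ℕ, ∑ m ∈ Finset.Icc (-(R : ℤ)) R, ((1 + h * |(m : ℝ)|) ^ 2)⁻¹ ≤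
      1 + 2 / h * (1 - (1 + h * R)⁻¹) := by
    intro R
    induction R with
    | zero => simp
    | succ R ih =>
      have hI : Finset.Icc (-((R + 1 : ℕ) : ℤ)) ((R + 1 : ℕ) : ℤ) =
          insert (-((R : ℤ) + 1)) (insert ((R : ℤ) + 1) (Finset.Icc (-(R : ℤ)) R)) := by
        ext m
        simp only [Finset.mem_Icc, Finset.mem_insert]
        omega
      rw [hI, Finset.sum_insert, Finset.sum_insert]
      · have hR : (0 : ℝ) ≤ R := Nat.cast_nonneg R
        have e1 : |(((R : ℤ) + 1 : ℤ) : ℝ)| = R + 1 := by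
          push_cast
          exact abs_of_nonneg (by positivity)
        have e2 : |((-((R : ℤ) + 1) : ℤ) : ℝ)| = R + 1 := by
          rw [Int.cast_neg, abs_neg, e1]
        rw [e1, e2]
        have hstep : ((1 + h * (R + 1)) ^ 2)⁻¹ ≤
            1 / h * ((1 + h * R)⁻¹ - (1 + h * (R + 1))⁻¹) := by
          have hp : 0 < 1 + h * R := by positivity
          have hq : 0 < 1 + h * (R + 1) := by positivity
          have : 1 / h * ((1 + h * R)⁻¹ - (1 + h * (R + 1))⁻¹) =
              ((1 + h * R) * (1 + h * (R + 1)))⁻¹ := by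
            field_simp
            ring
          rw [this]
          refine inv_anti₀ (by positivity) ?_
          rw [sq]
          refine mul_le_mul_of_nonneg_right ?_ hq.le
          nlinarith
        push_cast
        have : 2 / h * (1 - (1 + h * ((R : ℝ) + 1))⁻¹) = 2 / h * (1 - (1 + h * R)⁻¹) +
            2 * (1 / h * ((1 + h * R)⁻¹ - (1 + h * (R + 1))⁻¹)) := by ring
        linarith
      · simp
      · simp only [Finset.mem_insert, Finset.mem_Icc, not_or]
        omega
  refine (key R).trans ?_
  have hi : 0 ≤ (1 + h * R)⁻¹ := by positivity
  have h3 : 1 ≤ 1 / h := by rwa [le_div_iff₀ hh, one_mul]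
  have h4 : 2 / h * (1 - (1 + h * R)⁻¹) ≤ 2 / h :=
    mul_le_of_le_one_right (by positivity) (by linarith)
  calc 1 + 2 / h * (1 - (1 + h * R)⁻¹) ≤ 1 / h + 2 / h := add_le_add h3 h4
    _ = 3 / h := by ring

/-- The number of bins on which the average of the logarithms of the coordinates is at most `T`. -/
theorem exists_finset_bins (ι : Type*) [Fintype ι] {h : ℝ} (hh : 0 < h) (h1 : h ≤ 1) (T : ℝ) :
    ∃ S : Finset (ι → ℤ), (S.card : ℝ) ≤ (3 / h * Real.exp (2 * T)) ^ Fintype.card ι ∧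
      ∀ z : ι → ℤ, ∑ k, Real.log (1 + h * |(z k : ℝ)|) ≤ Fintype.card ι * T → z ∈ S := by
  classical
  set D := Fintype.card ι
  -- The box only ensures finiteness: all the logarithms are nonnegative, so each one is at most `D
  -- * T`. Its size does not enter the count.
  set R : ℕ := ⌈Real.exp (D * T) / h⌉₊
  set box := Fintype.piFinset fun _ : ι => Finset.Icc (-(R : ℤ)) R
  have hpos : ∀ m : ℤ, 0 < 1 + h * |(m : ℝ)| := fun m => by positivity
  refine ⟨box.filter fun z => ∑ k, Real.log (1 + h * |(z k : ℝ)|) ≤ D * T, ?_, ?_⟩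
  -- Chernoff weight: its product is at least one on every counted bin, while its sum over the box
  -- factorises. The exponent two makes the one-dimensional sums bounded.
  · set f : ℤ → ℝ := fun m => ((1 + h * |(m : ℝ)|) ^ 2)⁻¹ * Real.exp (2 * T)
    have hf : ∀ m, 0 ≤ f m := fun m => by positivity
    have hone : ∀ z : ι → ℤ, ∑ k, Real.log (1 + h * |(z k : ℝ)|) ≤ D * T →
        1 ≤ ∏ k, f (z k) := by
      intro z hz
      have hfe : ∀ m, f m = Real.exp (2 * T - 2 * Real.log (1 + h * |(m : ℝ)|)) := by
        intro m
        rw [sub_eq_neg_add, Real.exp_add, Real.exp_neg, two_mul (Real.log _), Real.exp_add,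
          Real.exp_log (hpos m), ← sq]
      simp_rw [hfe]
      rw [← Real.exp_sum, Finset.sum_sub_distrib, Finset.sum_const, ← Finset.mul_sum,
        Finset.card_univ, nsmul_eq_mul]
      refine Real.one_le_exp ?_
      change 0 ≤ (D : ℝ) * (2 * T) - 2 * ∑ k, Real.log (1 + h * |(z k : ℝ)|)
      linarith
    calc ((box.filter fun z => ∑ k, Real.log (1 + h * |(z k : ℝ)|) ≤ D * T).card : ℝ)
        = ∑ z ∈ box.filter fun z => ∑ k, Real.log (1 + h * |(z k : ℝ)|) ≤ D * T, 1 := by simp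
      _ ≤ ∑ z ∈ box.filter fun z => ∑ k, Real.log (1 + h * |(z k : ℝ)|) ≤ D * T,
          ∏ k, f (z k) :=
          Finset.sum_le_sum fun z hz => hone z (Finset.mem_filter.1 hz).2
      _ ≤ ∑ z ∈ box, ∏ k, f (z k) :=
          Finset.sum_le_sum_of_subset_of_nonneg (Finset.filter_subset _ _)
            fun z _ _ => Finset.prod_nonneg fun k _ => hf _
      _ = ∏ _k : ι, ∑ m ∈ Finset.Icc (-(R : ℤ)) R, f m :=
          (Finset.prod_univ_sum _ _).symm
      _ = (∑ m ∈ Finset.Icc (-(R : ℤ)) R, f m) ^ D := by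
          rw [Finset.prod_const, Finset.card_univ]
      _ ≤ (3 / h * Real.exp (2 * T)) ^ D := by
          refine pow_le_pow_left₀ (Finset.sum_nonneg fun m _ => hf m) ?_ D
          rw [← Finset.sum_mul]
          exact mul_le_mul_of_nonneg_right (sum_Icc_inv_sq_le hh h1 R) (Real.exp_pos _).le
  · intro z hz
    refine Finset.mem_filter.2 ⟨Fintype.mem_piFinset.2 fun k => ?_, hz⟩
    have hk : Real.log (1 + h * |(z k : ℝ)|) ≤ D * T :=
      (Finset.single_le_sum (f := fun k => Real.log (1 + h * |(z k : ℝ)|))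
        (fun j _ => Real.log_nonneg (by
          have : 0 ≤ h * |(z j : ℝ)| := by positivity
          linarith)) (Finset.mem_univ k)).trans hz
    rw [Real.log_le_iff_le_exp (hpos _)] at hk
    have hle : |(z k : ℝ)| ≤ R := by
      refine le_trans ?_ (Nat.le_ceil _)
      rw [le_div_iff₀ hh]
      linarith
    rw [abs_le] at hle
    rw [Finset.mem_Icc]
    constructor
    · exact_mod_cast hle.1
    · exact_mod_cast hle.2

end Counting

/-! ### Mass outside the relevant bins. -/

section Tail

variable {Ω : Type*} [MeasurableSpace Ω] {P : Measure Ω} [IsProbabilityMeasure P] {X : ℤ → Ω → ℝ}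

theorem IsStationary.identDistrib (hX : ∀ t, Measurable (X t)) (hs : IsStationary P X) (t : ℤ) :
    ProbabilityTheory.IdentDistrib (X t) (X 0) P P := by
  refine ⟨(hX t).aemeasurable, (hX 0).aemeasurable, ?_⟩
  have := hs.map_comp_shift hX (g := fun v => v 0) (measurable_pi_apply _) t 0
  simpa using this

/-- Markov's inequality for a sum of logarithms over the coordinates: mean and threshold both scale
with the dimension, which cancels. The `log 2` absorbs the rounding to the grid, since `1 + h|⌊x/h⌋|
≤ 2(1 + |x|)`. -/
theorem one_sub_sum_binProb_le (hX : ∀ t, Measurable (X t)) (hs : IsStationary P X)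
    (hlog : Integrable (fun ω => Real.log (1 + |X 0 ω|)) P) {ι : Type*} [Fintype ι]
    {h : ℝ} (hh : 0 < h) (h1 : h ≤ 1) (o : ι → ℕ) {T : ℝ} (hT : 0 < T) {S : Finset (ι → ℤ)}
    (hS : ∀ z : ι → ℤ, ∑ k, Real.log (1 + h * |(z k : ℝ)|) ≤ Fintype.card ι * T → z ∈ S) :
    1 - ∑ z ∈ S, binProb P X h o z ≤
      (Real.log 2 + ∫ ω, Real.log (1 + |X 0 ω|) ∂P) / T := by
  set K := Real.log 2 + ∫ ω, Real.log (1 + |X 0 ω|) ∂P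
  have hK : 0 ≤ K := add_nonneg (Real.log_nonneg (by norm_num))
    (integral_nonneg fun ω => Real.log_nonneg (by have := abs_nonneg (X 0 ω); linarith))
  set u : ℝ → ℝ := fun x => Real.log (1 + |x|)
  have hu : Measurable u := by fun_prop
  have hid := fun t => (hs.identDistrib hX t).comp hu
  have hint : ∀ t, Integrable (fun ω => u (X t ω)) P := fun t => (hid t).integrable_iff.2 hlog
  have hieq : ∀ t, ∫ ω, u (X t ω) ∂P = ∫ ω, u (X 0 ω) ∂P := fun t => (hid t).integral_eq
  set f : Ω → ℝ := fun ω => ∑ k, (Real.log 2 + u (X ((0 + 1 + o k : ℕ) : ℤ) ω))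
  have hf0 : 0 ≤ f := fun ω => Finset.sum_nonneg fun k _ =>
    add_nonneg (Real.log_nonneg (by norm_num)) (Real.log_nonneg (by
      have := abs_nonneg (X ((0 + 1 + o k : ℕ) : ℤ) ω)
      linarith))
  have hfi : Integrable f P :=
    integrable_finsetSum _ fun k _ => (integrable_const _).add (hint _)
  have hfint : ∫ ω, f ω ∂P = Fintype.card ι * K := by
    have hi : ∀ k, Integrable (fun ω => Real.log 2 + u (X ((0 + 1 + o k : ℕ) : ℤ) ω)) P :=
      fun k => (integrable_const _).add (hint _)
    simp only [f]
    rw [integral_finsetSum _ fun k _ => hi k]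
    have : ∀ k : ι, ∫ ω, (Real.log 2 + u (X ((0 + 1 + o k : ℕ) : ℤ) ω)) ∂P = K := fun k => by
      rw [integral_add (integrable_const _) (hint _), hieq]
      simp [K, u]
    simp_rw [this]
    rw [Finset.sum_const, Finset.card_univ, nsmul_eq_mul]
  have hpt : ∀ ω, ∑ k, Real.log (1 + h * |(windowBin h o (fun i => X i ω) 0 k : ℝ)|) ≤ f ω := by
    intro ω
    refine Finset.sum_le_sum fun k _ => ?_
    set x := X ((0 + 1 + o k : ℕ) : ℤ) ω
    have hx : (0 : ℝ) < 1 + |x| := by positivity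
    rw [← Real.log_mul (by norm_num) hx.ne']
    refine Real.log_le_log (by positivity) ?_
    change 1 + h * |(⌊x / h⌋ : ℝ)| ≤ 2 * (1 + |x|)
    have h2 : |(⌊x / h⌋ : ℝ)| ≤ |x| / h + 1 := by
      have h3 := Int.floor_le (x / h)
      have h4 := Int.lt_floor_add_one (x / h)
      have h5 : |x| / h = |x / h| := by rw [abs_div, abs_of_pos hh]
      rw [h5, abs_le]
      constructor <;> linarith [neg_abs_le (x / h), le_abs_self (x / h)]
    have h6 : h * |(⌊x / h⌋ : ℝ)| ≤ |x| + h := by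
      refine (mul_le_mul_of_nonneg_left h2 hh.le).trans_eq ?_
      field_simp
    linarith [abs_nonneg x]
  have hW := measurable_windowBin hX h o 0
  have hcompl := probReal_compl_eq_one_sub (μ := P) (hW S.measurableSet)
  change P.real {ω | windowBin h o (fun i => X i ω) 0 ∈ S}ᶜ =
    1 - P.real {ω | windowBin h o (fun i => X i ω) 0 ∈ S} at hcompl
  rw [sum_binProb hX, ← hcompl]
  rcases Nat.eq_zero_or_pos (Fintype.card ι) with hc | hc
  · have : {ω | windowBin h o (fun i => X i ω) 0 ∈ S}ᶜ = ∅ := by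
      refine Set.eq_empty_of_forall_notMem fun ω hω => hω (hS _ ?_)
      have := Fintype.card_eq_zero_iff.1 hc
      simp
    rw [this, measureReal_empty]
    positivity
  · have hc' : (0 : ℝ) < Fintype.card ι := by exact_mod_cast hc
    have hsub : {ω | windowBin h o (fun i => X i ω) 0 ∈ S}ᶜ ⊆
        {ω | Fintype.card ι * T ≤ f ω} := by
      intro ω hω
      by_contra hcon
      exact hω (hS _ ((hpt ω).trans (not_le.1 hcon).le))
    have hmk := mul_meas_ge_le_integral_of_nonneg (ae_of_all _ hf0) hfi (Fintype.card ι * T)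
    rw [hfint, mul_assoc] at hmk
    have := le_of_mul_le_mul_left hmk hc'
    rw [le_div_iff₀ hT, mul_comm]
    exact (mul_le_mul_of_nonneg_left (measureReal_mono hsub) hT.le).trans this

/-- The bin frequencies are close in `ℓ¹` to the bin probabilities. -/
theorem exists_integrable_bound_tsum_abs_binFreq_sub (hX : ∀ t, Measurable (X t))
    (hs : IsStationary P X) (hlog : Integrable (fun ω => Real.log (1 + |X 0 ω|)) P)
    {ι : Type*} [Fintype ι] {h : ℝ} (hh : 0 < h) (h1 : h ≤ 1) {o : ι → ℕ} {ℓ : ℕ}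
    (ho : ∀ k, o k ≤ ℓ) {N : ℕ} (hN : 0 < N) (g : ℕ) {T : ℝ} (hT : 0 < T) :
    ∃ Y : Ω → ℝ, Integrable Y P ∧
      (∀ ω, ∑' z, |binFreq h o N (fun i => X i ω) z - binProb P X h o z| ≤ Y ω) ∧
      ∫ ω, Y ω ∂P ≤
        2 * √(2 * (ℓ + g) * (3 / h * Real.exp (2 * T)) ^ Fintype.card ι / N) +
          4 * betaCoeff P X g +
          2 * ((Real.log 2 + ∫ ω, Real.log (1 + |X 0 ω|) ∂P) / T) := by
  obtain ⟨S, hcard, hS⟩ := exists_finset_bins ι hh h1 T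
  have htail := one_sub_sum_binProb_le hX hs hlog hh h1 o hT hS
  have hmain := integral_sum_abs_binFreq_sub_le hX hs h o ho hN g S
  have hi : Integrable (fun ω => ∑ z ∈ S,
      |binFreq h o N (fun i => X i ω) z - binProb P X h o z|) P := by
    refine integrable_finsetSum _ fun z _ => Integrable.abs (Integrable.sub ?_ (integrable_const _))
    simp_rw [binFreq_eq_sum]
    refine Integrable.div_const (integrable_finsetSum _ fun i _ => ?_) _
    refine (integrable_indicator_one (P := P) (measurable_windowBin hX h o i
      (measurableSet_singleton z))).congr (ae_of_all _ fun ω => ?_)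
    by_cases hz : windowBin h o (fun i => X i ω) i = z <;> simp [hz]
  have hle : √(2 * (ℓ + g) * S.card / N) ≤
      √(2 * (ℓ + g) * (3 / h * Real.exp (2 * T)) ^ Fintype.card ι / N) := by
    refine Real.sqrt_le_sqrt ?_
    gcongr
  refine ⟨fun ω => 2 * ∑ z ∈ S, |binFreq h o N (fun i => X i ω) z - binProb P X h o z| +
    2 * (1 - ∑ z ∈ S, binProb P X h o z), (hi.const_mul 2).add (integrable_const _),
    fun ω => tsum_abs_sub_le (hasSum_binFreq h o hN _) (hasSum_binProb hX h o)
      (binFreq_nonneg h o N _) (binProb_nonneg P X h o) S, ?_⟩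
  rw [integral_add (hi.const_mul 2) (integrable_const _), integral_const_mul, integral_const,
    probReal_univ, one_smul]
  linarith

end Tail

/-! ### The Lambert function and growth rates. -/

section Rates

/-- The intermediate value theorem on `[0, y]` gives a preimage; uniqueness plays no role. -/
theorem lambertW_spec {y : ℝ} (hy : 0 ≤ y) :
    -1 ≤ lambertW y ∧ lambertW y * Real.exp (lambertW y) = y := by
  have hex : ∃ w ∈ Set.Ici (-1 : ℝ), w * Real.exp w = y := by
    have hc : ContinuousOn (fun w : ℝ => w * Real.exp w) (Set.Icc 0 y) := by fun_prop
    have hmem : y ∈ Set.Icc ((0 : ℝ) * Real.exp 0) (y * Real.exp y) := by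
      rw [zero_mul]
      exact ⟨hy, le_mul_of_one_le_right hy (Real.one_le_exp hy)⟩
    obtain ⟨w, hw, hwy⟩ := intermediate_value_Icc hy hc hmem
    exact ⟨w, by simp only [Set.mem_Ici]; linarith [hw.1], hwy⟩
  exact ⟨Function.invFunOn_mem hex, Function.invFunOn_eq hex⟩

theorem tendsto_lambertW : Tendsto lambertW atTop atTop := by
  refine tendsto_atTop.2 fun A => ?_
  filter_upwards [eventually_gt_atTop (|A| * Real.exp |A|), eventually_ge_atTop 0] with y hy hy0
  obtain ⟨-, h⟩ := lambertW_spec hy0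
  by_contra hcon
  have hle : lambertW y ≤ |A| := (not_le.1 hcon).le.trans (le_abs_self A)
  have : lambertW y * Real.exp (lambertW y) ≤ |A| * Real.exp |A| :=
    (mul_le_mul_of_nonneg_right hle (Real.exp_pos _).le).trans
      (mul_le_mul_of_nonneg_left (Real.exp_le_exp.2 hle) (abs_nonneg A))
  linarith

theorem tendsto_lambertW_log : Tendsto (fun n : ℕ => lambertW (Real.log n)) atTop atTop :=
  tendsto_lambertW.comp (Real.tendsto_log_atTop.comp tendsto_natCast_atTop_atTop)

theorem log_eq_lambertW {n : ℕ} (hn : 1 ≤ n) :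
    lambertW (Real.log n) * Real.exp (lambertW (Real.log n)) = Real.log n :=
  (lambertW_spec (Real.log_nonneg (by exact_mod_cast hn))).2

/-- Substituting `log n = w e^w`, the numerator of the exponent becomes `w (1 + e^w / 2)`, so the
exponent is exactly `w / log n`. -/
theorem rpow_bandwidthExponent {n : ℕ} (hn : 2 ≤ n) (γ : ℝ) :
    (n : ℝ) ^ (-(γ * bandwidthExponent n)) = Real.exp (-(γ * lambertW (Real.log n))) := by
  have hn' : (1 : ℝ) < n := by exact_mod_cast hn
  have hL := Real.log_pos hn'
  have hw := log_eq_lambertW (show 1 ≤ n by omega)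
  rw [Real.rpow_def_of_pos (by linarith)]
  congr 1
  rw [bandwidthExponent]
  set w := lambertW (Real.log n)
  set L := Real.log n
  have he := Real.exp_pos w
  field_simp
  rw [← hw]
  ring

theorem eventually_bandwidth_bounds {γ : ℝ} {h : ℕ → ℝ}
    (hh : IsEquivalent atTop h (fun n : ℕ => (n : ℝ) ^ (-(γ * bandwidthExponent n)))) :
    ∀ᶠ n : ℕ in atTop, 1 / 2 * Real.exp (-(γ * lambertW (Real.log n))) ≤ h n ∧
      h n ≤ 2 * Real.exp (-(γ * lambertW (Real.log n))) := by
  filter_upwards [hh.isLittleO.bound (show (0 : ℝ) < 1 / 2 by norm_num), eventually_ge_atTop 2]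
    with n hn h2
  simp only [Pi.sub_apply] at hn
  rw [rpow_bandwidthExponent h2, Real.norm_eq_abs, Real.norm_eq_abs, Real.abs_exp, abs_le] at hn
  have := Real.exp_pos (-(γ * lambertW (Real.log n)))
  constructor <;> linarith [hn.1, hn.2]

theorem tendsto_bandwidth {γ : ℝ} (hγ : 0 < γ) {h : ℕ → ℝ}
    (hh : IsEquivalent atTop h (fun n : ℕ => (n : ℝ) ^ (-(γ * bandwidthExponent n)))) :
    Tendsto h atTop (𝓝 0) := by
  have he : Tendsto (fun n : ℕ => Real.exp (-(γ * lambertW (Real.log n)))) atTop (𝓝 0) :=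
    Real.tendsto_exp_neg_atTop_nhds_zero.comp (tendsto_lambertW_log.const_mul_atTop hγ)
  have h2 := he.const_mul 2
  rw [mul_zero] at h2
  refine tendsto_of_tendsto_of_tendsto_of_le_of_le' tendsto_const_nhds h2 ?_ ?_
  · filter_upwards [eventually_bandwidth_bounds hh] with n hn
    exact le_trans (by positivity) hn.1
  · filter_upwards [eventually_bandwidth_bounds hh] with n hn using hn.2

theorem eventually_dim_le {d : ℕ → ℕ} {C : ℝ}
    (hC : IsBigOWith C atTop (fun n => (d n : ℝ)) dimRate) :
    ∀ᶠ n : ℕ in atTop, (d n : ℝ) ≤ C * Real.exp (lambertW (Real.log n)) := by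
  filter_upwards [hC.bound] with n hn
  rwa [Real.norm_natCast, dimRate, Real.norm_eq_abs, Real.abs_exp] at hn

/-- With `x = e^w`, the window length is `O(x)` while `n = exp(w x)` is at least quadratic in `x`.
-/
theorem eventually_sample_size {d : ℕ → ℕ} {C : ℝ}
    (hC : IsBigOWith C atTop (fun n => (d n : ℝ)) dimRate) (a : ℕ) :
    ∀ᶠ n : ℕ in atTop, (n : ℝ) / 2 ≤ ((n + 2 - (2 * d n + a) : ℕ) : ℝ) ∧ 2 * d n + a < n + 2 := by
  have he : Tendsto (fun n : ℕ => Real.exp (lambertW (Real.log n))) atTop atTop :=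
    Real.tendsto_exp_atTop.comp tendsto_lambertW_log
  filter_upwards [eventually_dim_le hC, he.eventually_ge_atTop (8 * |C| + 4 * a + 1),
    tendsto_lambertW_log.eventually_ge_atTop 1, eventually_ge_atTop 1] with n hd hx hw hn
  set w := lambertW (Real.log n)
  set x := Real.exp w
  have hC0 := abs_nonneg C
  have ha : (0 : ℝ) ≤ a := Nat.cast_nonneg a
  have hx1 : 1 ≤ x := by linarith
  have hnx : 1 + x + x ^ 2 / 2 ≤ n := by
    have h1 : (n : ℝ) = Real.exp (w * x) := by
      rw [log_eq_lambertW hn, Real.exp_log (by exact_mod_cast hn)]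
    rw [h1]
    refine (Real.quadratic_le_exp_of_nonneg (by linarith)).trans (Real.exp_le_exp.2 ?_)
    nlinarith
  have hdx : (d n : ℝ) ≤ |C| * x :=
    hd.trans (mul_le_mul_of_nonneg_right (le_abs_self C) (by linarith))
  have hkey : 2 * (d n : ℝ) + a ≤ n / 2 := by nlinarith
  have hlt : 2 * d n + a < n + 2 := by
    have : ((2 * d n + a : ℕ) : ℝ) < ((n + 2 : ℕ) : ℝ) := by
      push_cast
      linarith [(Nat.cast_nonneg n : (0 : ℝ) ≤ n)]
    exact_mod_cast this
  refine ⟨?_, hlt⟩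
  rw [Nat.cast_sub hlt.le]
  push_cast
  linarith

/-- The number of relevant bins is small compared to the sample size. -/
theorem tendsto_bin_count_div_sample_size {d : ℕ → ℕ} {C : ℝ}
    (hC : IsBigOWith C atTop (fun n => (d n : ℝ)) dimRate) {γ : ℝ} (hγ : 0 < γ)
    (hγC : 2 * C * γ < 1) {h : ℕ → ℝ}
    (hh : IsEquivalent atTop h (fun n : ℕ => (n : ℝ) ^ (-(γ * bandwidthExponent n))))
    (a g : ℕ) {T : ℝ} (hT : 0 < T) :
    Tendsto (fun n => 2 * (((2 * d n + a : ℕ) : ℝ) + g) *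
      (3 / h n * Real.exp (2 * T)) ^ (2 * d n) / ((n + 2 - (2 * d n + a) : ℕ) : ℝ))
      atTop (𝓝 0) := by
  set c : ℝ := Real.log 6 + 2 * T
  have hc : 0 < c := add_pos (Real.log_pos (by norm_num)) (by linarith)
  -- Logarithm of the final bound, up to the factor `4`. The terms in `c` and `γ` come from `3/h ≤ 6
  -- e^{γw}` raised to the power `2d`, `2C` and `a + g` from bounding the window length by an
  -- exponential, and `-w e^w` from dividing by `n`.
  set e : ℝ → ℝ := fun w => Real.exp w * ((2 * C * c + 2 * C) - (1 - 2 * C * γ) * w) + (a + g)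
  have hlim : Tendsto (fun n : ℕ => 4 * Real.exp (e (lambertW (Real.log n)))) atTop (𝓝 0) := by
    have he : Tendsto e atTop atBot := by
      refine tendsto_atBot_add_const_right _ _ ?_
      refine Real.tendsto_exp_atTop.atTop_mul_atBot₀ ?_
      have : Tendsto (fun w : ℝ => (1 - 2 * C * γ) * w) atTop atTop :=
        tendsto_id.const_mul_atTop (by linarith)
      simp_rw [sub_eq_add_neg (2 * C * c + 2 * C)]
      exact tendsto_atBot_add_const_left _ _ (tendsto_neg_atTop_atBot.comp this)
    have := ((Real.tendsto_exp_atBot.comp he).comp tendsto_lambertW_log).const_mul 4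
    simpa using this
  refine tendsto_of_tendsto_of_tendsto_of_le_of_le' tendsto_const_nhds hlim ?_ ?_
  · filter_upwards [eventually_bandwidth_bounds hh] with n hn
    have : 0 < h n := lt_of_lt_of_le (by positivity) hn.1
    positivity
  · filter_upwards [eventually_bandwidth_bounds hh, eventually_dim_le hC,
      eventually_sample_size hC a, tendsto_lambertW_log.eventually_ge_atTop 0,
      eventually_ge_atTop 1] with n hhn hd hN hw hn
    set w := lambertW (Real.log n)
    have hhpos : 0 < h n := lt_of_lt_of_le (by positivity) hhn.1
    have hnpos : (0 : ℝ) < n := by exact_mod_cast hn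
    have hnexp : (n : ℝ) = Real.exp (w * Real.exp w) := by
      rw [log_eq_lambertW hn, Real.exp_log hnpos]
    have hbase : 3 / h n * Real.exp (2 * T) ≤ Real.exp (γ * w + c) := by
      have : 3 / h n ≤ 6 * Real.exp (γ * w) := by
        rw [div_le_iff₀ hhpos]
        have := mul_le_mul_of_nonneg_left hhn.1 (show 0 ≤ 6 * Real.exp (γ * w) by positivity)
        have hee : Real.exp (γ * w) * Real.exp (-(γ * w)) = 1 := by
          rw [← Real.exp_add, add_neg_cancel, Real.exp_zero]
        nlinarith
      calc 3 / h n * Real.exp (2 * T) ≤ 6 * Real.exp (γ * w) * Real.exp (2 * T) :=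
            mul_le_mul_of_nonneg_right this (Real.exp_pos _).le
        _ = Real.exp (γ * w + c) := by
            simp only [c]
            rw [Real.exp_add, Real.exp_add, Real.exp_log (by norm_num)]
            ring
    have hpow : (3 / h n * Real.exp (2 * T)) ^ (2 * d n) ≤
        Real.exp (2 * (C * Real.exp w) * (γ * w + c)) := by
      refine (pow_le_pow_left₀ (by positivity) hbase _).trans ?_
      rw [← Real.exp_nat_mul]
      refine Real.exp_le_exp.2 (mul_le_mul_of_nonneg_right ?_ (by positivity))
      push_cast
      linarith
    have hlen : ((2 * d n + a : ℕ) : ℝ) + g ≤ Real.exp (2 * (C * Real.exp w) + (a + g)) := by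
      refine le_trans ?_ (Real.add_one_le_exp _)
      push_cast
      linarith
    calc 2 * (((2 * d n + a : ℕ) : ℝ) + g) *
        (3 / h n * Real.exp (2 * T)) ^ (2 * d n) / ((n + 2 - (2 * d n + a) : ℕ) : ℝ)
        ≤ 2 * Real.exp (2 * (C * Real.exp w) + (a + g)) *
          Real.exp (2 * (C * Real.exp w) * (γ * w + c)) / (n / 2) := by
          refine div_le_div₀ (by positivity) ?_ (by positivity) hN.1
          exact mul_le_mul (mul_le_mul_of_nonneg_left hlen (by norm_num)) hpow (by positivity)
            (by positivity)
      _ = 4 * Real.exp (e w) := by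
          have : e w = (2 * (C * Real.exp w) + (a + g)) +
            2 * (C * Real.exp w) * (γ * w + c) - w * Real.exp w := by
            simp only [e]
            ring
          rw [this, Real.exp_sub, Real.exp_add _ (2 * (C * Real.exp w) * (γ * w + c)), hnexp]
          field_simp
          ring

end Rates

/-! ### Assembling the error bound. -/

section Consistency

variable {Ω : Type*} [MeasurableSpace Ω] {P : Measure Ω} [IsProbabilityMeasure P] {X : ℤ → Ω → ℝ}

/-- The estimator differs from the mixing coefficient of the discretized windows by an error whose
mean is controlled by the number of bins, the mixing coefficient at any lag `g`, and the tails. -/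
theorem exists_integrable_bound_betaHat_sub (hX : ∀ t, Measurable (X t))
    (hs : IsStationary P X) (hlog : Integrable (fun ω => Real.log (1 + |X 0 ω|)) P)
    {h : ℝ} (hh : 0 < h) (h1 : h ≤ 1) {d a n : ℕ} (ha : 0 < a) (hn : 2 * d + a < n + 2)
    (g : ℕ) {T : ℝ} (hT : 0 < T) :
    ∃ Y : Ω → ℝ, Integrable Y P ∧ 0 ≤ Y ∧
      (∀ ω, |betaHat h d a n (fun i => X i ω) -
        (1 / 2 * ∑' c : (Fin d → ℤ) × (Fin d → ℤ),
          |binProb P X h (pairOffset d a) (Sum.elim c.1 c.2) -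
            binProb P X h (fun k : Fin d => (k : ℕ)) c.1 *
              binProb P X h (fun k : Fin d => (k : ℕ)) c.2|)| ≤ Y ω) ∧
      ∫ ω, Y ω ∂P ≤
        3 * √(2 * (((2 * d + a : ℕ) : ℝ) + g) * (3 / h * Real.exp (2 * T)) ^ (2 * d) /
          ((n + 2 - (2 * d + a) : ℕ) : ℝ)) +
          6 * betaCoeff P X g +
          3 * ((Real.log 2 + ∫ ω, Real.log (1 + |X 0 ω|) ∂P) / T) := by
  have hN2 : 0 < n + 2 - (2 * d + a) := by omega
  have hN1 : 0 < n + 1 - d := by omega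
  have ho2 : ∀ k, pairOffset d a k ≤ 2 * d + a := by
    rintro (k | k) <;> simp only [pairOffset, Sum.elim_inl, Sum.elim_inr] <;> omega
  have ho1 : ∀ k : Fin d, (k : ℕ) ≤ 2 * d + a := fun k => by omega
  obtain ⟨Y2, hi2, hle2, hint2⟩ :=
    exists_integrable_bound_tsum_abs_binFreq_sub hX hs hlog hh h1 ho2 hN2 g hT
  obtain ⟨Y1, hi1, hle1, hint1⟩ :=
    exists_integrable_bound_tsum_abs_binFreq_sub hX hs hlog hh h1 ho1 hN1 g hT
  rw [Fintype.card_sum, Fintype.card_fin, ← two_mul] at hint2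
  rw [Fintype.card_fin] at hint1
  have hone : 1 ≤ 3 / h * Real.exp (2 * T) := by
    refine one_le_mul_of_one_le_of_one_le ?_ (Real.one_le_exp (by linarith))
    rw [le_div_iff₀ hh]
    linarith
  -- The error for single windows is dominated by that for pairs, which have more bins and a smaller
  -- sample. Adding half of the latter gives the coefficients 3, 6, 3.
  have hsq : √(2 * (((2 * d + a : ℕ) : ℝ) + g) * (3 / h * Real.exp (2 * T)) ^ d /
      ((n + 1 - d : ℕ) : ℝ)) ≤
      √(2 * (((2 * d + a : ℕ) : ℝ) + g) * (3 / h * Real.exp (2 * T)) ^ (2 * d) /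
        ((n + 2 - (2 * d + a) : ℕ) : ℝ)) := by
    refine Real.sqrt_le_sqrt ?_
    refine div_le_div₀ (by positivity) ?_ (by exact_mod_cast hN2) ?_
    · exact mul_le_mul_of_nonneg_left (pow_le_pow_right₀ hone (by omega)) (by positivity)
    · exact_mod_cast (by omega : n + 2 - (2 * d + a) ≤ n + 1 - d)
  have h02 : ∀ ω, 0 ≤ Y2 ω := fun ω => (tsum_nonneg fun _ => abs_nonneg _).trans (hle2 ω)
  have h01 : ∀ ω, 0 ≤ Y1 ω := fun ω => (tsum_nonneg fun _ => abs_nonneg _).trans (hle1 ω)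
  refine ⟨fun ω => 1 / 2 * Y2 ω + Y1 ω, (hi2.const_mul _).add hi1,
    fun ω => add_nonneg (mul_nonneg (by norm_num) (h02 ω)) (h01 ω), fun ω => ?_, ?_⟩
  · rw [betaHat_eq_tsum hh d ha]
    refine (abs_half_tsum_sub_half_tsum_le (hasSum_binFreq h _ hN1 _) (hasSum_binProb hX h _)
      (hasSum_binFreq h _ hN2 _) (hasSum_binProb hX h _) (binFreq_nonneg h _ _ _)
      (binProb_nonneg P X h _)).trans ?_
    have := hle2 ω
    have := hle1 ω
    linarith
  · rw [integral_add (hi2.const_mul _) hi1, integral_const_mul]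
    linarith

end Consistency

end BetaMixing

theorem theorem1
    (d : ℕ → ℕ) (hd : Tendsto d atTop atTop)
    (C : ℝ) (hC : IsBigOWith C atTop (fun n => (d n : ℝ)) BetaMixing.dimRate)
    (γ : ℝ) (hγ : 0 < γ) (hγC : 2 * C * γ < 1)
    (h : ℕ → ℝ)
    (hh : IsEquivalent atTop h (fun n : ℕ => (n : ℝ) ^ (-(γ * BetaMixing.bandwidthExponent n))))
    {Ω : Type*} [MeasurableSpace Ω] (P : Measure Ω) [IsProbabilityMeasure P]
    (X : ℤ → Ω → ℝ) (hX : ∀ t, Measurable (X t))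
    (hstat : BetaMixing.IsStationary P X) (hmix : BetaMixing.IsBetaMixing P X)
    (hlog : Integrable (fun ω => Real.log (1 + |X 0 ω|)) P)
    (a : ℕ) (ha : 0 < a) :
    TendstoInMeasure P
      (fun n ω => BetaMixing.betaHat (h n) (d n) a n (fun i => X i ω)) atTop
      (fun _ => BetaMixing.betaCoeff P X a) := by
  have hpos : ∀ᶠ n in atTop, 0 < h n := by
    filter_upwards [BetaMixing.eventually_bandwidth_bounds hh] with n hn
    exact lt_of_lt_of_le (by positivity) hn.1
  have h0 := BetaMixing.tendsto_bandwidth hγ hh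
  have hbias := BetaMixing.tendsto_half_tsum_binProb hX hstat ha hd hpos h0
  rw [tendstoInMeasure_iff_measureReal_dist]
  intro ε hε
  rw [tendsto_order]
  refine ⟨fun x hx => .of_forall fun n => hx.trans_le measureReal_nonneg, fun η hη => ?_⟩
  set K := Real.log 2 + ∫ ω, Real.log (1 + |X 0 ω|) ∂P
  have hK : 0 ≤ K := add_nonneg (Real.log_nonneg (by norm_num))
    (integral_nonneg fun ω => Real.log_nonneg (by linarith [abs_nonneg (X 0 ω)]))
  -- The three error terms are at most `3δ`, `6δ` and `3δ`; their total `12δ = εη/3` stays below the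
  -- `εη/2` that Markov's inequality at level `ε/2` requires.
  set δ := ε * η / 36
  have hδ : 0 < δ := by positivity
  obtain ⟨g, hg⟩ := (hmix.eventually (gt_mem_nhds hδ)).exists
  set T := (K + 1) / δ
  have hT : 0 < T := by positivity
  have hKT : K / T < δ := by
    rw [div_lt_iff₀ hT]
    have : δ * T = K + 1 := by
      simp only [T]
      field_simp
    linarith
  have hcount := ((BetaMixing.tendsto_bin_count_div_sample_size hC hγ hγC hh a g hT).sqrt)
  rw [Real.sqrt_zero] at hcount
  filter_upwards [hpos, h0.eventually (gt_mem_nhds one_pos), hcount.eventually (gt_mem_nhds hδ),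
    BetaMixing.eventually_sample_size hC a,
    hbias.eventually (Metric.ball_mem_nhds _ (half_pos hε))] with n hn hn1 hcn hsize hbn
  obtain ⟨Y, hYi, hY0, hYle, hYint⟩ := BetaMixing.exists_integrable_bound_betaHat_sub hX hstat hlog
    hn hn1.le ha hsize.2 g hT
  -- The bias is below `ε/2`, so an error of size `ε` must come from the fluctuation.
  have hsub : {ω | ε ≤ dist (BetaMixing.betaHat (h n) (d n) a n (fun i => X i ω))
      (BetaMixing.betaCoeff P X a)} ⊆ {ω | ε / 2 ≤ Y ω} := by
    intro ω hω
    have h1 := hYle ω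
    rw [← Real.dist_eq] at h1
    have h2 := (Set.mem_ofPred_eq ▸ hω).trans (dist_triangle _ _ _ |>.trans
      (add_le_add h1 (Metric.mem_ball.1 hbn).le))
    simp only [Set.mem_ofPred_eq]
    linarith
  have hmk := mul_meas_ge_le_integral_of_nonneg (ae_of_all _ hY0) hYi (ε / 2)
  have hY : ∫ ω, Y ω ∂P < 12 * δ := by linarith
  have h3 : ε / 2 * P.real {ω | ε / 2 ≤ Y ω} < ε / 2 * η := by
    have : 12 * δ = ε * η / 3 := by
      simp only [δ]
      ring
    nlinarith [mul_pos hε hη]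
  exact (measureReal_mono hsub).trans_lt (lt_of_mul_lt_mul_left h3 (by positivity))
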